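/- A seller offers a finite set $I$ of items to a single buyer, whose type is a monotone valuation $v:2^{I}\to\mathbb{R}_{\ge 0}$ drawn from a known probability distribution $\mathcal D$. A \emph{lottery} $\lambda=(x,p)$ consists of a probability distribution $x$ over subsets of $I$ and a price $p\ge 0$; its utility for type $v$ is $\mathbb{E}_{S\sim x}[v(S)]-p$. A \emph{menu} $\Lambda$ is a set of lotteries; a buyer of type $v$ selects a lottery of $\Lambda$ of maximal utility, the most expensive one in case of ties, and pays its price. The revenue of $\Lambda$ is the expected payment over $v\sim\mathcal D$. An \emph{item pricing} is a vector $(p_i)_{i\in I}$ of non-negative prices, with the menu that sells every $S\subseteq I$ deterministically at price $\sum_{i\in S}p_i$. An \emph{adaptive algorithm} on $\Lambda$ purchases a finite or infinite sequence of lotteries of $\Lambda$, choosing each one (or stopping) depending on the sets instantiated by the previous ones; it obtains the union of all sets and pays the sum of all prices. A menu $\Lambda$ is \emph{buy-many} if for every adaptive algorithm on $\Lambda$ there is $\lambda\in\Lambda$ whose price is at most the expected total payment of the algorithm, and a coupling of a draw $S$ from $\lambda$ with the union $S'$ obtained by the algorithm such that $S\supseteq S'$. Let $\mathrm{ItemRev}(\mathcal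 D)$ and $\mathrm{BuyManyRev}(\mathcal D)$, in $[0,\infty]$, be the suprema of the revenues of all item pricings and of all buy-many menus. Given a partial order $\preceq$ on $I$, a valuation is \emph{partially ordered} if $v(S\cup\{i,j\})=v(S\cup\{j\})$ for all $i\preceq j$ and $S\subseteq I$; the \emph{width} of $\preceq$ is the size of its largest antichain. If $I$ is partitioned into $k$ categories, each of them totally ordered, then $v$ is a \emph{$k$-category valuation} if $v(S)$ depends only on the best item of each category contained in $S$. For $I=\{1,\dots,n\}$, $v$ is \emph{totally ordered} if $v(S)=\max_{i\in S}v(\{i\})$ for all $S$ (with $v(\emptyset)=0$) and $v(\{1\})\le\dots\le v(\{n\})$. \textbf{Theorem.} There are absolute constants $C,c>0$ such that the following hold. \begin{enumerate} \item For every finite partially ordered set of items of width $k$ and every distribution $\mathcal D$ over monotone partially ordered valuations, $\mathrm{BuyManyRev}(\mathcal D)\le C(1+\log k)\,\mathrm{ItemRev}(\mathcal D)$ (where for the empty set of items, of width $0$, the factor is read as $C$). The same holds for every distribution over monotone $k$-category valuations. For every distribution over totally ordered valuations, $\mathrm{BuyManyRev}(\mathcal D)\le C\,\mathrm{ItemRev}(\mathcal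 D)$. \item The gap is tight: for every $k\ge 1$ there are items in $k$ non-empty categories and a distribution $\mathcal D$ over monotone $k$-category valuations with $0<\mathrm{ItemRev}(\mathcal D)$, $\mathrm{BuyManyRev}(\mathcal D)<\infty$ and $\mathrm{BuyManyRev}(\mathcal D)\ge c(1+\log k)\,\mathrm{ItemRev}(\mathcal D)$. \end{enumerate} -/

import Mathlib

open MeasureTheory Filter Topology
open scoped NNReal ENNReal

namespace OrderedItems

/-! ### Valuations -/

/-- A valuation assigns a non-negative value to every set of items. A distribution over valuations
is a probability measure on this type with its product (Borel) sigma-algebra. -/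
abbrev Valuation (ι : Type) : Type := Finset ι → ℝ≥0

/-- The valuation `v` is partially ordered with respect to the order of the items: whenever
`i ≤ j` (the item `j` dominates `i`), the item `i` is worth nothing next to `j`. -/
def IsPartiallyOrdered {ι : Type} [DecidableEq ι] [PartialOrder ι] (v : Valuation ι) : Prop :=
  ∀ i j : ι, i ≤ j → ∀ S : Finset ι, v (S ∪ {i, j}) = v (S ∪ {j})

open Classical in
/-- The width of a finite partial order: the size of its largest antichain. -/
noncomputable def width (ι : Type) [Fintype ι] [PartialOrder ι] : ℕ :=
  (Finset.univ.filter fun A : Finset ι => IsAntichain (· ≤ ·) (A : Set ι)).sup Finset.card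

/-- The items of a `k`-category instance: category `a` consists of `m a` items, which are totally
ordered as `0 < 1 < ⋯ < m a - 1`. -/
abbrev CategoryItem {k : ℕ} (m : Fin k → ℕ) : Type := Σ a : Fin k, Fin (m a)

/-- The best item of category `a` contained in the bundle `S` (`⊥` if there is none). -/
def bestItem {k : ℕ} {m : Fin k → ℕ} (S : Finset (CategoryItem m)) (a : Fin k) :
    WithBot (Fin (m a)) :=
  (Finset.univ.filter fun j : Fin (m a) => (⟨a, j⟩ : CategoryItem m) ∈ S).max

/-- A `k`-category valuation: the value of a bundle depends only on the best item of every
category that it contains. -/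
def IsCategoryValuation {k : ℕ} {m : Fin k → ℕ} (v : Valuation (CategoryItem m)) : Prop :=
  ∀ S T : Finset (CategoryItem m), (∀ a, bestItem S a = bestItem T a) → v S = v T

/-- A unit-demand valuation with totally ordered values `v₁ ≤ v₂ ≤ ⋯ ≤ vₙ`. -/
def IsTotallyOrdered {n : ℕ} (v : Valuation (Fin n)) : Prop :=
  (∀ S : Finset (Fin n), v S = S.sup fun i => v {i}) ∧ Monotone fun i : Fin n => v {i}

/-! ### Menus -/

/-- A lottery: a random set of items, and a price. A (buy-one) mechanism is a menu, that is,
a set of lotteries. -/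
structure Lottery (ι : Type) where
  alloc : PMF (Finset ι)
  price : ℝ≥0

/-- The utility of a buyer of type `v` for a lottery: expected value minus price. -/
noncomputable def utility {ι : Type} [Fintype ι] (v : Valuation ι) (l : Lottery ι) : ℝ :=
  ∑ S : Finset ι, (l.alloc S).toReal * (v S : ℝ) - (l.price : ℝ)

/-- The payment of a buyer of type `v`, who chooses a utility-maximizing lottery of the menu, the
most expensive one in the case of ties. -/
noncomputable def payment {ι : Type} [Fintype ι] (Λ : Set (Lottery ι)) (v : Valuation ι) : ℝ≥0∞ :=
  ⨆ l ∈ {l ∈ Λ | ∀ l' ∈ Λ, utility v l' ≤ utility v l}, (l.price : ℝ≥0∞)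

/-- The expected revenue of a menu when the type of the buyer is drawn from `D`. -/
noncomputable def revenue {ι : Type} [Fintype ι] (D : Measure (Valuation ι))
    (Λ : Set (Lottery ι)) : ℝ≥0∞ :=
  ∫⁻ v, payment Λ v ∂D

/-- The menu of an item pricing: every set of items is sold at the sum of its item prices. -/
noncomputable def itemMenu {ι : Type} (p : ι → ℝ≥0) : Set (Lottery ι) :=
  Set.range fun S : Finset ι => ⟨PMF.pure S, ∑ i ∈ S, p i⟩

/-- The optimal item pricing revenue. -/
noncomputable def itemRev {ι : Type} [Fintype ι] (D : Measure (Valuation ι)) : ℝ≥0∞ :=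
  ⨆ p : ι → ℝ≥0, revenue D (itemMenu p)

/-! ### The buy-many constraint -/

/-- An adaptive algorithm decides, given the sets instantiated by the previous purchases (most
recent first), which lottery to purchase next, or to stop (`none`). It may also go on forever. -/
abbrev Algorithm (ι : Type) : Type := List (Finset ι) → Option (Lottery ι)

/-- The distribution of the list of instantiated sets after at most `t` purchases. -/
noncomputable def history {ι : Type} (A : Algorithm ι) : ℕ → PMF (List (Finset ι))
  | 0 => PMF.pure []
  | t + 1 => (history A t).bind fun h =>
      match A h with
      | none => PMF.pure h
      | some l => l.alloc.map fun S => S :: h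

/-- The union of all instantiated sets of a history. -/
def bundle {ι : Type} [DecidableEq ι] (h : List (Finset ι)) : Finset ι :=
  h.foldr (· ∪ ·) ∅

/-- What the algorithm pays for the purchase that follows the history `h`. -/
noncomputable def nextPrice {ι : Type} (A : Algorithm ι) (h : List (Finset ι)) : ℝ≥0∞ :=
  match A h with
  | none => 0
  | some l => l.price

/-- The expected total payment of an adaptive algorithm (possibly infinite). -/
noncomputable def expectedPayment {ι : Type} (A : Algorithm ι) : ℝ≥0∞ :=
  ∑' t : ℕ, ∑' h : List (Finset ι), history A t h * nextPrice A h

/-- The lottery `l` dominates the allocation of the algorithm `A`: there is a coupling `γ` of a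
draw `S` from `l` with the union `S'` of all sets that `A` obtains, such that `S' ⊆ S`. The unions
of the first `t` sets increase with `t`, so the law of `S'` is the limit of their laws. -/
def Dominates {ι : Type} [DecidableEq ι] (l : Lottery ι) (A : Algorithm ι) : Prop :=
  ∃ γ : PMF (Finset ι × Finset ι),
    γ.map Prod.fst = l.alloc ∧
    (∀ T : Finset ι,
      Tendsto (fun t => ((history A t).map bundle) T) atTop (𝓝 ((γ.map Prod.snd) T))) ∧
    ∀ z ∈ γ.support, z.2 ⊆ z.1

/-- The buy-many constraint: every adaptive algorithm that purchases lotteries of the menu is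
dominated by a single lottery of the menu that is at most as expensive. -/
def IsBuyMany {ι : Type} [DecidableEq ι] (Λ : Set (Lottery ι)) : Prop :=
  ∀ A : Algorithm ι, (∀ h l, A h = some l → l ∈ Λ) →
    ∃ l ∈ Λ, (l.price : ℝ≥0∞) ≤ expectedPayment A ∧ Dominates l A

/-- The optimal revenue of a buy-many mechanism. -/
noncomputable def buyManyRev {ι : Type} [Fintype ι] [DecidableEq ι]
    (D : Measure (Valuation ι)) : ℝ≥0∞ :=
  ⨆ Λ ∈ {Λ : Set (Lottery ι) | IsBuyMany Λ}, revenue D Λ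

end OrderedItems

/-!
Item pricing against buy-many menus, for ordered items.

*Upper bound.* Let `Λ` be a buy-many menu. The acquisition cost `q i` of an item is the cheapest
expected cost of obtaining an item at least as good as `i` by repeated purchases of one lottery.
The item pricings used are the scalings `2⁻ʲ q`, for `j = 0, 1, 2, …`. Let `w j` be the optimal
utility of a fixed buyer under `2⁻ʲ q`, let `R j` be her payment, and let `p` be the price of the
lottery that she purchases in `Λ`.

* She can acquire any bundle adaptively at its acquisition cost, so `w 0` is at most her utility in
  `Λ` (`exists_utility_ge`).
* The bundle bought at scale `j + 1` costs twice as much at scale `j`, so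
  `w (j + 1) ≤ w j + R (j + 1)`.
* A bundle `S` is worth no more than its maximal items, so `v S ≤ w j + 2⁻ʲ Q S` for their cost
  `Q S`. If `S` is drawn from a lottery with price `p`, then `Q S ≥ t` has probability at most
  `k² p / t`, where `k` bounds the width (`topCost_tail`). Only antichains have to be counted for
  this; no decomposition into chains is needed.

Evaluating the bound on `v S` at a scale `j` that depends on `Q S`, namely `J + 2 m` for
`Q S ≈ 2 ^ m k² p` and `2 ^ J ≈ 4 k²`, bounds `p` by a weighted sum of the payments `R j`
(`price_le_weighted_sum`). The scales up to `J` have weight one, and the weights of the scales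
beyond `J` decay geometrically because of the tail bound. The total weight is
`J + 4 = O(1 + log k)`, and integrating over the types gives `buyManyRev_le`.
Category valuations and totally ordered valuations are special cases.

*Lower bound.* Identify `q ^ 2` of the items with a plane over a finite field with `q = 2 ^ m`
elements, choose slopes `s 0, …, s m`, and consider buyers who are additive over a line of slope
`s j` with total value `2 ^ j`, with weight `2⁻ʲ`. The lines of a fixed slope are disjoint, so
in an item pricing an item of price `y` earns, up to weights, only the sum of `2⁻ʲ y` over the
levels with `2 ^ j ≥ q y`; this geometric sum does not grow with `m` (`itemRev_spreadMeasure_le`).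
(For `m = 0` there is one line, a single item.)
Lines of different slopes share at most one item, so the menu of all lotteries that leave no type
any surplus sells every line at its full value. This menu is buy-many because the valuations are
subadditive (`isBuyMany_surplusFreeMenu`), and it earns the same from each of the `m + 1` levels.
-/

namespace OrderedItems

/-! ### Expectations along the run of an adaptive algorithm -/

/-- The expectation of an extended non-negative function under a probability mass function. -/
noncomputable def expect {α : Type} (μ : PMF α) (f : α → ℝ≥0∞) : ℝ≥0∞ := ∑' a, μ a * f a

section Expect

variable {α β : Type}

lemma expect_pure (a : α) (f : α → ℝ≥0∞) : expect (PMF.pure a) f = f a := by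
  unfold expect
  rw [tsum_eq_single a (fun b hb => by simp [PMF.pure_apply, hb])]
  simp

lemma expect_bind (μ : PMF α) (g : α → PMF β) (f : β → ℝ≥0∞) :
    expect (μ.bind g) f = expect μ fun a => expect (g a) f := by
  simp only [expect, PMF.bind_apply, ← ENNReal.tsum_mul_right, ← ENNReal.tsum_mul_left]
  rw [ENNReal.tsum_comm]
  simp only [mul_assoc]

lemma expect_map (μ : PMF α) (g : α → β) (f : β → ℝ≥0∞) :
    expect (μ.map g) f = expect μ fun a => f (g a) := by
  rw [PMF.map, expect_bind]
  simp only [Function.comp_apply, expect_pure]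

lemma expect_mono (μ : PMF α) {f g : α → ℝ≥0∞} (h : ∀ a, f a ≤ g a) :
    expect μ f ≤ expect μ g :=
  ENNReal.tsum_le_tsum fun a => mul_le_mul_right (h a) _

lemma expect_add (μ : PMF α) (f g : α → ℝ≥0∞) :
    expect μ (fun a => f a + g a) = expect μ f + expect μ g := by
  simp only [expect, mul_add, ENNReal.tsum_add]

lemma expect_const_mul (μ : PMF α) (c : ℝ≥0∞) (f : α → ℝ≥0∞) :
    expect μ (fun a => c * f a) = c * expect μ f := by
  simp only [expect, ← ENNReal.tsum_mul_left, mul_left_comm]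

lemma expect_const (μ : PMF α) (c : ℝ≥0∞) : expect μ (fun _ => c) = c := by
  simp [expect, ENNReal.tsum_mul_right, μ.tsum_coe]

open Classical in
lemma apply_eq_expect (μ : PMF α) (a : α) :
    μ a = expect μ fun b => if b = a then 1 else 0 := by
  unfold expect
  rw [tsum_eq_single a (fun b hb => by simp [hb])]
  simp

/-- The expected value of `f` after one more step of `A` from the history `h`. -/
noncomputable def nextExpect (A : Algorithm α) (f : List (Finset α) → ℝ≥0∞)
    (h : List (Finset α)) : ℝ≥0∞ :=
  match A h with
  | none => f h
  | some l => expect l.alloc fun S => f (S :: h)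

lemma nextExpect_none {A : Algorithm α} {h : List (Finset α)} (f : List (Finset α) → ℝ≥0∞)
    (hA : A h = none) : nextExpect A f h = f h := by
  simp [nextExpect, hA]

lemma nextExpect_some {A : Algorithm α} {h : List (Finset α)} {l : Lottery α}
    (f : List (Finset α) → ℝ≥0∞) (hA : A h = some l) :
    nextExpect A f h = expect l.alloc fun S => f (S :: h) := by
  simp [nextExpect, hA]

lemma expect_history_zero (A : Algorithm α) (f : List (Finset α) → ℝ≥0∞) :
    expect (history A 0) f = f [] :=
  expect_pure _ _

lemma expect_history_succ (A : Algorithm α) (t : ℕ) (f : List (Finset α) → ℝ≥0∞) :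
    expect (history A (t + 1)) f = expect (history A t) (nextExpect A f) := by
  rw [history, expect_bind]
  congr 1
  funext h
  cases hA : A h with
  | none => simp only [expect_pure, nextExpect_none f hA]
  | some l => simp only [expect_map, nextExpect_some f hA]

lemma expectedPayment_eq (A : Algorithm α) :
    expectedPayment A = ∑' t, expect (history A t) (nextPrice A) := rfl

/-- A potential that in expectation decreases by at least the running cost bounds the total
cost. -/
lemma tsum_expect_le_of_potential (A : Algorithm α) (cost f : List (Finset α) → ℝ≥0∞)
    (hf : ∀ h, nextExpect A f h + cost h ≤ f h) :
    ∑' t, expect (history A t) cost ≤ f [] := by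
  have key : ∀ N, ∑ t ∈ Finset.range N, expect (history A t) cost + expect (history A N) f
      ≤ f [] := by
    intro N
    induction N with
    | zero => simp [expect_history_zero]
    | succ N ih =>
      refine le_trans ?_ ih
      rw [Finset.sum_range_succ, expect_history_succ, add_assoc, add_comm (expect _ cost),
        ← expect_add]
      gcongr
      exact expect_mono _ hf
  rw [ENNReal.tsum_eq_iSup_nat]
  exact iSup_le fun N => le_self_add.trans (key N)

/-- A function that in expectation increases by at most the next price is bounded in expectation
by the total payment. -/
lemma expect_history_le_expectedPayment (A : Algorithm α) (f : List (Finset α) → ℝ≥0∞)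
    (h0 : f [] = 0) (hf : ∀ h, nextExpect A f h ≤ f h + nextPrice A h) (t : ℕ) :
    expect (history A t) f ≤ expectedPayment A := by
  have key : ∀ N, expect (history A N) f
      ≤ ∑ t ∈ Finset.range N, expect (history A t) (nextPrice A) := by
    intro N
    induction N with
    | zero => simp [expect_history_zero, h0]
    | succ N ih =>
      rw [Finset.sum_range_succ, expect_history_succ]
      calc expect (history A N) (nextExpect A f)
          ≤ expect (history A N) (fun h => f h + nextPrice A h) := expect_mono _ hf
        _ ≤ _ := by rw [expect_add]; gcongr
  rw [expectedPayment_eq]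
  exact (key t).trans (ENNReal.sum_le_tsum _)

end Expect

/-! ### The law of everything that an adaptive algorithm obtains -/

section LimitLaw

variable {ι : Type} [DecidableEq ι]

lemma map_bundle_apply (A : Algorithm ι) (t : ℕ) (T : Finset ι) :
    ((history A t).map bundle) T
      = expect (history A t) fun h => if bundle h = T then 1 else 0 := by
  rw [apply_eq_expect, expect_map]
  congr 1
  funext h
  split_ifs <;> simp_all

/-- The bundle only grows along a run. With the indicator of an upper set of bundles as `f`, the
probability of having reached that upper set is monotone in the number of purchases. -/
lemma monotone_expect_history (A : Algorithm ι) (f : Finset ι → ℝ≥0∞) (hf : Monotone f) :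
    Monotone fun t => expect (history A t) fun h => f (bundle h) := by
  refine monotone_nat_of_le_succ fun t => ?_
  rw [expect_history_succ]
  refine expect_mono _ fun h => ?_
  cases hA : A h with
  | none => rw [nextExpect_none _ hA]
  | some l =>
    rw [nextExpect_some _ hA]
    calc f (bundle h) = expect l.alloc fun _ => f (bundle h) := (expect_const _ _).symm
      _ ≤ _ := expect_mono _ fun S => hf (Finset.subset_union_right : bundle h ⊆ S ∪ bundle h)

/-- The laws of the union of the first `t` sets converge: each of their point masses is a difference
of the probabilities of two upper sets, and both are monotone in `t`. -/
lemma exists_limit_law [Fintype ι] (A : Algorithm ι) :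
    ∃ μ : PMF (Finset ι), ∀ T,
      Tendsto (fun t => ((history A t).map bundle) T) atTop (𝓝 (μ T)) := by
  have hex : ∀ T : Finset ι, ∃ x : ℝ≥0∞,
      Tendsto (fun t => ((history A t).map bundle) T) atTop (𝓝 x) := by
    intro T
    -- both `T ⊆ S` and `T ⊂ S` are upward closed in `S`
    set f : Finset ι → ℝ≥0∞ := fun S => if T ⊆ S then 1 else 0 with hf
    set g : Finset ι → ℝ≥0∞ := fun S => if T ⊂ S then 1 else 0 with hg
    have hfm : Monotone f := fun S S' h => by
      by_cases h1 : T ⊆ S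
      · simp [hf, h1, h1.trans h]
      · simp [hf, h1]
    have hgm : Monotone g := fun S S' h => by
      by_cases h1 : T ⊂ S
      · simp [hg, h1, h1.trans_subset h]
      · simp [hg, h1]
    have hg1 : ∀ t, expect (history A t) (fun h => g (bundle h)) ≤ 1 := fun t => by
      rw [← expect_const (history A t) 1]
      exact expect_mono _ fun h => by simp only [hg]; split_ifs <;> simp
    have heq : ∀ t, ((history A t).map bundle) T
        = expect (history A t) (fun h => f (bundle h))
          - expect (history A t) (fun h => g (bundle h)) := by
      intro t
      refine ENNReal.eq_sub_of_add_eq (ne_top_of_le_ne_top ENNReal.one_ne_top (hg1 t)) ?_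
      rw [map_bundle_apply, ← expect_add]
      congr 1
      funext h
      by_cases h1 : bundle h = T
      · simp [hf, hg, h1]
      · by_cases h2 : T ⊆ bundle h
        · simp [hf, hg, h1, h2, h2.ssubset_of_ne (Ne.symm h1)]
        · have h3 : ¬ T ⊂ bundle h := fun h3 => h2 h3.subset
          simp [hf, hg, h1, h2, h3]
    simp only [heq]
    exact ⟨_, ENNReal.Tendsto.sub (tendsto_atTop_iSup (monotone_expect_history A f hfm))
      (tendsto_atTop_iSup (monotone_expect_history A g hgm))
      (Or.inr (ne_top_of_le_ne_top ENNReal.one_ne_top (iSup_le hg1)))⟩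
  choose x hx using hex
  have hsum : ∑ T, x T = 1 := by
    refine tendsto_nhds_unique (tendsto_finsetSum _ fun T _ => hx T) ?_
    have : ∀ t, ∑ T, ((history A t).map bundle) T = 1 := fun t => by
      rw [← tsum_fintype (L := .unconditional _)]; exact PMF.tsum_coe _
    simp only [this, tendsto_const_nhds]
  exact ⟨PMF.ofFintype x hsum, hx⟩

end LimitLaw

/-! ### Acquiring a set of items adaptively -/

section Acquire

variable {ι : Type} [PartialOrder ι]

open Classical in
/-- The probability that the lottery `l` allocates an item that is at least as good as `i`. -/
noncomputable def hitProb (l : Lottery ι) (i : ι) : ℝ≥0∞ :=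
  expect l.alloc fun S => if ∃ j ∈ S, i ≤ j then 1 else 0

lemma hitProb_le_one (l : Lottery ι) (i : ι) : hitProb l i ≤ 1 := by
  rw [← expect_const l.alloc 1]
  exact expect_mono _ fun S => by split_ifs <;> simp

variable [DecidableEq ι]

open Classical in
/-- The items of `T` for which `S` contains no item that is at least as good. -/
noncomputable def missing (T S : Finset ι) : Finset ι :=
  T.filter fun i => ¬ ∃ j ∈ S, i ≤ j

open Classical in
/-- The algorithm that keeps purchasing the lottery `ℓ i` of some missing item `i` of `T`, until
no item of `T` is missing. -/
noncomputable def coverAlg (T : Finset ι) (ℓ : ι → Lottery ι) : Algorithm ι := fun h =>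
  if hU : (missing T (bundle h)).Nonempty then some (ℓ hU.choose) else none

open Classical in
/-- If every purchase of `ℓ i` costs `c i` times its probability of covering `i`, then the
expected total cost of covering `T` is at most the sum of the `c i`: the sum over the missing
items is a potential. -/
lemma tsum_coverAlg_cost_le (T : Finset ι) (ℓ : ι → Lottery ι) (c : ι → ℝ≥0∞) :
    ∑' t, expect (history (coverAlg T ℓ) t) (fun h =>
      if hU : (missing T (bundle h)).Nonempty then
        hitProb (ℓ hU.choose) hU.choose * c hU.choose else 0) ≤ ∑ i ∈ T, c i := by
  have h0 : ∑ i ∈ missing T (bundle []), c i = ∑ i ∈ T, c i := by simp [missing, bundle]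
  rw [← h0]
  refine tsum_expect_le_of_potential _ _ (fun h => ∑ i ∈ missing T (bundle h), c i) fun h => ?_
  by_cases hU : (missing T (bundle h)).Nonempty
  · have hA : coverAlg T ℓ h = some (ℓ hU.choose) := by simp [coverAlg, hU]
    rw [nextExpect_some _ hA, dif_pos hU]
    obtain ⟨i, hi⟩ : ∃ i, hU.choose = i := ⟨_, rfl⟩
    have hmem : i ∈ missing T (bundle h) := hi ▸ hU.choose_spec
    rw [hi, hitProb, mul_comm, ← expect_const_mul, ← expect_add,
      ← expect_const (ℓ i).alloc (∑ i ∈ missing T (bundle h), c i)]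
    refine expect_mono _ fun S => ?_
    have hsub : missing T (bundle (S :: h)) ⊆ missing T (bundle h) := fun x hx => by
      simp only [missing, Finset.mem_filter] at hx ⊢
      exact ⟨hx.1, fun ⟨j, hj, hxj⟩ => hx.2 ⟨j, Finset.mem_union_right _ hj, hxj⟩⟩
    split_ifs with hS
    · have hni : i ∉ missing T (bundle (S :: h)) := fun hx => by
        simp only [missing, Finset.mem_filter] at hx
        obtain ⟨j, hj, hij⟩ := hS
        exact hx.2 ⟨j, Finset.mem_union_left _ hj, hij⟩
      rw [mul_one, add_comm, ← Finset.sum_insert hni]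
      exact Finset.sum_le_sum_of_subset (Finset.insert_subset hmem hsub)
    · rw [mul_zero, add_zero]
      exact Finset.sum_le_sum_of_subset hsub
  · have hA : coverAlg T ℓ h = none := by simp [coverAlg, hU]
    rw [nextExpect_none _ hA, dif_neg hU, add_zero]

/-- A buy-many menu contains a lottery that covers all of `T` with certainty, at a price of at
most the sum of the expected costs of covering each item of `T` by repeated purchases. -/
lemma exists_covering_lottery [Fintype ι] {Λ : Set (Lottery ι)} (hΛ : IsBuyMany Λ) (T : Finset ι)
    (ℓ : ι → Lottery ι) (hℓ : ∀ i ∈ T, ℓ i ∈ Λ) (hpos : ∀ i ∈ T, hitProb (ℓ i) i ≠ 0) :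
    ∃ l ∈ Λ, (l.price : ℝ≥0∞) ≤ ∑ i ∈ T, (ℓ i).price / hitProb (ℓ i) i ∧
      ∀ S, l.alloc S ≠ 0 → ∀ i ∈ T, ∃ j ∈ S, i ≤ j := by
  classical
  have hchoose : ∀ S (hU : (missing T S).Nonempty), hU.choose ∈ T := fun S hU =>
    (Finset.mem_filter.1 hU.choose_spec).1
  have htop : ∀ i, hitProb (ℓ i) i ≠ ⊤ := fun i =>
    ne_top_of_le_ne_top ENNReal.one_ne_top (hitProb_le_one _ _)
  obtain ⟨l, hl, hprice, γ, hγ1, hγ2, hγ⟩ := hΛ (coverAlg T ℓ) (by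
    intro h l hA
    by_cases hU : (missing T (bundle h)).Nonempty
    · simp only [coverAlg, hU, dite_true, Option.some.injEq] at hA
      exact hA ▸ hℓ _ (hchoose _ hU)
    · simp [coverAlg, hU] at hA)
  refine ⟨l, hl, hprice.trans ?_, ?_⟩
  · refine le_trans (le_of_eq ?_) (tsum_coverAlg_cost_le T ℓ fun i => (ℓ i).price / hitProb (ℓ i) i)
    rw [expectedPayment_eq]
    congr 1; funext t; congr 1; funext h
    by_cases hU : (missing T (bundle h)).Nonempty
    · simp only [nextPrice, coverAlg, hU, dite_true]
      exact (ENNReal.mul_div_cancel (hpos _ (hchoose _ hU)) (htop _)).symm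
    · simp only [nextPrice, coverAlg, hU, dite_false]
  · -- with `c i = 1 / hitProb`, the same potential bounds the expected number of purchases
    have hfin : ∑' t, expect (history (coverAlg T ℓ) t)
        (fun h => if (missing T (bundle h)).Nonempty then 1 else 0) ≠ ⊤ := by
      refine ne_top_of_le_ne_top ?_
        (le_trans (le_of_eq ?_) (tsum_coverAlg_cost_le T ℓ fun i => (hitProb (ℓ i) i)⁻¹))
      · exact ENNReal.sum_ne_top.2 fun i hi => ENNReal.inv_ne_top.2 (hpos i hi)
      · congr 1; funext t; congr 1; funext h
        by_cases hU : (missing T (bundle h)).Nonempty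
        · simp only [hU, dite_true, if_true]
          exact (ENNReal.mul_inv_cancel (hpos _ (hchoose _ hU)) (htop _)).symm
        · simp only [hU, dite_false, if_false]
    -- so the probability of not having covered `T` after `t` purchases tends to `0`
    have hlim := ENNReal.tendsto_atTop_zero_of_tsum_ne_top hfin
    have hsnd : ∀ S', (γ.map Prod.snd) S' ≠ 0 → ¬ (missing T S').Nonempty := by
      intro S' hS' hU
      refine hS' (tendsto_nhds_unique (hγ2 S') ?_)
      refine tendsto_of_tendsto_of_tendsto_of_le_of_le tendsto_const_nhds hlim
        (fun _ => zero_le) fun t => ?_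
      simp only [map_bundle_apply]
      refine expect_mono _ fun h => ?_
      split_ifs with h1 h2
      · exact le_rfl
      · exact absurd (h1 ▸ hU) h2
      all_goals simp
    intro S hS i hi
    rw [← hγ1, ← PMF.mem_support_iff, PMF.mem_support_map_iff] at hS
    obtain ⟨z, hz, rfl⟩ := hS
    have h2 : (γ.map Prod.snd) z.2 ≠ 0 :=
      (PMF.mem_support_iff _ _).1 ((PMF.mem_support_map_iff _ _ _).2 ⟨z, hz, rfl⟩)
    by_contra hcon
    refine hsnd _ h2 ⟨i, Finset.mem_filter.2 ⟨hi, ?_⟩⟩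
    rintro ⟨j, hj, hij⟩
    exact hcon ⟨j, hγ z hz hj, hij⟩

end Acquire

/-! ### Acquisition costs of single items -/

section AcquisitionCost

variable {ι : Type} [PartialOrder ι]

/-- The infimum of the expected costs of acquiring an item that is at least as good as `i`, by
repeated purchases of a single lottery of the menu; `⊤` if no lottery of the menu ever allocates
such an item. -/
noncomputable def acquisitionCost (Λ : Set (Lottery ι)) (i : ι) : ℝ≥0∞ :=
  ⨅ l ∈ Λ, ⨅ _ : hitProb l i ≠ 0, l.price / hitProb l i

lemma acquisitionCost_le {Λ : Set (Lottery ι)} {l : Lottery ι} (hl : l ∈ Λ) {i : ι}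
    (h : hitProb l i ≠ 0) : acquisitionCost Λ i ≤ l.price / hitProb l i :=
  iInf_le_of_le l (iInf_le_of_le hl (iInf_le _ h))

lemma acquisitionCost_ne_top {Λ : Set (Lottery ι)} {l : Lottery ι} (hl : l ∈ Λ) {i : ι}
    (h : hitProb l i ≠ 0) : acquisitionCost Λ i ≠ ⊤ :=
  ne_top_of_le_ne_top (ENNReal.div_ne_top ENNReal.coe_ne_top h) (acquisitionCost_le hl h)

lemma hitProb_toReal_mul_acquisitionCost_le {Λ : Set (Lottery ι)} {l : Lottery ι} (hl : l ∈ Λ)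
    (i : ι) : (hitProb l i).toReal * (acquisitionCost Λ i).toReal ≤ l.price := by
  by_cases h : hitProb l i = 0
  · simp [h]
  · have h1 : hitProb l i * acquisitionCost Λ i ≤ l.price := by
      refine (mul_le_mul_right (acquisitionCost_le hl h) _).trans (le_of_eq ?_)
      exact ENNReal.mul_div_cancel h (ne_top_of_le_ne_top ENNReal.one_ne_top (hitProb_le_one _ _))
    rw [← ENNReal.toReal_mul]
    exact ENNReal.toReal_le_of_le_ofReal l.price.coe_nonneg (by simpa using h1)

lemma exists_lottery_div_hitProb_le {Λ : Set (Lottery ι)} {i : ι} (h : acquisitionCost Λ i ≠ ⊤)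
    {ε : ℝ} (hε : 0 < ε) :
    ∃ l ∈ Λ, hitProb l i ≠ 0 ∧
      l.price / hitProb l i ≤ ENNReal.ofReal ((acquisitionCost Λ i).toReal + ε) := by
  have hlt : acquisitionCost Λ i < ENNReal.ofReal ((acquisitionCost Λ i).toReal + ε) := by
    rw [ENNReal.lt_ofReal_iff_toReal_lt h]
    linarith
  rw [acquisitionCost] at hlt
  simp only [iInf_lt_iff] at hlt
  obtain ⟨l, hl, hpos, hle⟩ := hlt
  exact ⟨l, hl, hpos, hle.le⟩

variable [Fintype ι]

omit [PartialOrder ι] in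
lemma expect_toReal {μ : PMF (Finset ι)} (p : Finset ι → Prop) [DecidablePred p] :
    (expect μ fun S => if p S then 1 else 0).toReal
      = ∑ S with p S, (μ S).toReal := by
  rw [expect, tsum_fintype, ENNReal.toReal_sum, Finset.sum_filter]
  · refine Finset.sum_congr rfl fun S _ => ?_
    split_ifs <;> simp
  · intro S _
    split_ifs <;> simp [PMF.apply_ne_top]

omit [PartialOrder ι] in
lemma sum_toReal_eq_one (μ : PMF (Finset ι)) : ∑ S, (μ S).toReal = 1 := by
  rw [← ENNReal.toReal_sum (fun S _ => μ.apply_ne_top S), ← tsum_fintype (L := .unconditional _),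
    μ.tsum_coe, ENNReal.toReal_one]

omit [Fintype ι] in
lemma hitProb_ne_zero {l : Lottery ι} {S : Finset ι} (hS : l.alloc S ≠ 0) {i j : ι}
    (hj : j ∈ S) (hij : i ≤ j) : hitProb l i ≠ 0 := by
  classical
  intro h
  rw [hitProb, expect, ENNReal.tsum_eq_zero] at h
  have := h S
  rw [if_pos ⟨j, hj, hij⟩, mul_one] at this
  exact hS this

section Covering

variable [DecidableEq ι]

omit [Fintype ι] in
/-- For a partially ordered valuation, a bundle that dominates every item of `T` is worth at least
as much as `T`. -/
lemma le_of_forall_exists_le {v : Valuation ι} (hv : Monotone v) (hpo : IsPartiallyOrdered v)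
    {S T : Finset ι} (h : ∀ i ∈ T, ∃ j ∈ S, i ≤ j) : v T ≤ v S := by
  have key : v (S ∪ T) = v S := by
    induction T using Finset.induction_on with
    | empty => simp
    | insert i T _ ih =>
      obtain ⟨j, hj, hij⟩ := h i (Finset.mem_insert_self _ _)
      have h1 := hpo i j hij (S ∪ T)
      have e1 : S ∪ T ∪ {i, j} = S ∪ insert i T := by
        ext x; simp only [Finset.mem_union, Finset.mem_insert, Finset.mem_singleton]
        constructor
        · rintro ((h | h) | (h | h)) <;> simp_all
        · rintro (h | (h | h)) <;> simp_all
      have e2 : S ∪ T ∪ {j} = S ∪ T := by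
        ext x; simp only [Finset.mem_union, Finset.mem_singleton]
        constructor
        · rintro ((h | h) | h) <;> simp_all
        · rintro (h | h) <;> simp_all
      rw [e1, e2] at h1
      rw [h1, ih fun i hi => h i (Finset.mem_insert_of_mem hi)]
  rw [← key]
  exact hv Finset.subset_union_right

/-- In a buy-many menu, the buyer can secure the value of any bundle of available items at
(almost) the sum of the acquisition costs of its items. -/
lemma exists_utility_ge {Λ : Set (Lottery ι)} (hΛ : IsBuyMany Λ) {v : Valuation ι}
    (hv : Monotone v) (hpo : IsPartiallyOrdered v) {T : Finset ι}
    (hT : ∀ i ∈ T, acquisitionCost Λ i ≠ ⊤) {ε : ℝ} (hε : 0 < ε) :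
    ∃ l ∈ Λ, (v T : ℝ) - ∑ i ∈ T, (acquisitionCost Λ i).toReal - ε ≤ utility v l := by
  have hδ : 0 < ε / (T.card + 1) := by positivity
  have hex : ∀ i, ∃ l : Lottery ι, i ∈ T → l ∈ Λ ∧ hitProb l i ≠ 0 ∧ l.price / hitProb l i
      ≤ ENNReal.ofReal ((acquisitionCost Λ i).toReal + ε / (T.card + 1)) := by
    intro i
    by_cases hi : i ∈ T
    · obtain ⟨l, h⟩ := exists_lottery_div_hitProb_le (hT i hi) hδ
      exact ⟨l, fun _ => h⟩
    · exact ⟨⟨PMF.pure ∅, 0⟩, fun h => absurd h hi⟩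
  choose ℓ hℓ using hex
  obtain ⟨l, hl, hprice, hcov⟩ := exists_covering_lottery hΛ T ℓ (fun i hi => (hℓ i hi).1)
    (fun i hi => (hℓ i hi).2.1)
  refine ⟨l, hl, ?_⟩
  have hprice' : (l.price : ℝ) ≤ ∑ i ∈ T, (acquisitionCost Λ i).toReal + ε := by
    have h1 : (l.price : ℝ≥0∞)
        ≤ ENNReal.ofReal (∑ i ∈ T, ((acquisitionCost Λ i).toReal + ε / (T.card + 1))) := by
      rw [ENNReal.ofReal_sum_of_nonneg fun i _ => by positivity]
      exact hprice.trans (Finset.sum_le_sum fun i hi => (hℓ i hi).2.2)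
    have h2 := ENNReal.toReal_le_of_le_ofReal (by positivity) h1
    rw [Finset.sum_add_distrib, Finset.sum_const, nsmul_eq_mul] at h2
    have h3 : (T.card : ℝ) * (ε / (T.card + 1)) ≤ ε := by
      rw [mul_div_assoc', div_le_iff₀ (by positivity)]
      nlinarith
    simpa using h2.trans (add_le_add_right h3 _)
  have hval : (v T : ℝ) ≤ ∑ S, (l.alloc S).toReal * (v S : ℝ) := by
    calc (v T : ℝ) = ∑ S, (l.alloc S).toReal * (v T : ℝ) := by
          rw [← Finset.sum_mul, sum_toReal_eq_one, one_mul]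
      _ ≤ _ := Finset.sum_le_sum fun S _ => by
          by_cases hS : l.alloc S = 0
          · simp [hS]
          · have : v T ≤ v S := le_of_forall_exists_le hv hpo (hcov S hS)
            gcongr
  unfold utility
  linarith

end Covering

open Classical in
/-- The maximal items of a bundle. For a partially ordered valuation they carry all its value. -/
noncomputable def topItems (S : Finset ι) : Finset ι := S.filter fun i => Maximal (· ∈ S) i

/-- The sum of the acquisition costs of the maximal items of a bundle. -/
noncomputable def topCost (Λ : Set (Lottery ι)) (S : Finset ι) : ℝ :=
  ∑ i ∈ topItems S, (acquisitionCost Λ i).toReal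

omit [Fintype ι] in
lemma topItems_subset (S : Finset ι) : topItems S ⊆ S := by
  classical
  exact Finset.filter_subset _ _

omit [Fintype ι] in
lemma exists_topItems_ge {S : Finset ι} {i : ι} (hi : i ∈ S) : ∃ j ∈ topItems S, i ≤ j := by
  classical
  obtain ⟨j, hij, hj⟩ := S.exists_le_maximal hi
  exact ⟨j, Finset.mem_filter.2 ⟨hj.prop, hj⟩, hij⟩

lemma card_le_width {A : Finset ι} (hA : IsAntichain (· ≤ ·) (A : Set ι)) :
    A.card ≤ width ι := by
  classical
  unfold width
  refine Finset.le_sup (f := Finset.card) ?_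
  simpa using hA

lemma card_topItems_le (S : Finset ι) : (topItems S).card ≤ width ι := by
  classical
  refine card_le_width ?_
  have : ((topItems S : Finset ι) : Set ι) = {i | Maximal (· ∈ S) i} := by
    ext i
    simp only [topItems, Finset.coe_filter, Set.mem_ofPred_eq]
    exact ⟨fun h => h.2, fun h => ⟨h.prop, h⟩⟩
  rw [this]
  exact setOfPred_maximal_antichain _

open Classical in
/-- A Markov-type bound: a lottery of the menu with price `p` allocates a bundle whose maximal
items cost at least `t` with probability at most `k² p / t`, where `k` bounds the width. Some
maximal item then costs at least `t / k`, hence the bundle dominates one of the at most `k` minimal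
items of cost at least `t / k`, and each of these is dominated with probability at most
`p k / t`. -/
lemma topCost_tail {Λ : Set (Lottery ι)} {l : Lottery ι} (hl : l ∈ Λ) {k : ℝ} (hk : 1 ≤ k)
    (hw : (width ι : ℝ) ≤ k) {t : ℝ} (ht : 0 < t) :
    t * ∑ S with t ≤ topCost Λ S, (l.alloc S).toReal ≤ k ^ 2 * l.price := by
  have hk0 : 0 < k := by linarith
  set q : ι → ℝ := fun i => (acquisitionCost Λ i).toReal with hq
  set B : Finset ι := Finset.univ.filter fun i => t / k ≤ q i with hB
  set Mn : Finset ι := B.filter fun i => Minimal (· ∈ B) i with hMn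
  have hcard : (Mn.card : ℝ) ≤ k := by
    refine le_trans ?_ hw
    have : ((Mn : Finset ι) : Set ι) = {i | Minimal (· ∈ B) i} := by
      ext i
      simp only [hMn, Finset.coe_filter, Set.mem_ofPred_eq]
      exact ⟨fun h => h.2, fun h => ⟨h.prop, h⟩⟩
    exact_mod_cast card_le_width (this ▸ setOfPred_minimal_antichain _)
  have hhit : ∀ i ∈ Mn, (hitProb l i).toReal ≤ l.price / (t / k) := by
    intro i hi
    have hi' : t / k ≤ q i := by
      have := (Finset.mem_filter.1 hi).1
      simpa [hB] using this
    rw [le_div_iff₀ (by positivity)]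
    exact (mul_le_mul_of_nonneg_left hi' ENNReal.toReal_nonneg).trans
      (hitProb_toReal_mul_acquisitionCost_le hl i)
  have hcov : ∀ S, t ≤ topCost Λ S → ∃ m ∈ Mn, ∃ j ∈ S, m ≤ j := by
    intro S hS
    obtain ⟨i, hi, hqi⟩ : ∃ i ∈ topItems S, t / k ≤ q i := by
      by_contra! hcon
      have hne : (topItems S).Nonempty := by
        rw [Finset.nonempty_iff_ne_empty]
        intro h
        simp only [topCost, h, Finset.sum_empty] at hS
        linarith
      have h1 : topCost Λ S < ∑ i ∈ topItems S, t / k := Finset.sum_lt_sum_of_nonempty hne hcon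
      rw [Finset.sum_const, nsmul_eq_mul] at h1
      have h2 : ((topItems S).card : ℝ) ≤ k :=
        le_trans (by exact_mod_cast card_topItems_le S) hw
      have h3 : ((topItems S).card : ℝ) * (t / k) ≤ k * (t / k) := by gcongr
      rw [mul_div_cancel₀ _ hk0.ne'] at h3
      linarith
    have hiB : i ∈ B := by simp [hB, hqi]
    obtain ⟨m, hmi, hm⟩ := B.exists_le_minimal hiB
    exact ⟨m, Finset.mem_filter.2 ⟨hm.prop, hm⟩, i, topItems_subset S hi, hmi⟩
  have hsum : ∑ S with t ≤ topCost Λ S, (l.alloc S).toReal ≤ ∑ i ∈ Mn, (hitProb l i).toReal := by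
    simp only [hitProb, expect_toReal, Finset.sum_filter]
    rw [Finset.sum_comm]
    refine Finset.sum_le_sum fun S _ => ?_
    have hnn : ∀ m ∈ Mn, 0 ≤ if ∃ j ∈ S, m ≤ j then (l.alloc S).toReal else 0 := fun m _ => by
      split_ifs <;> simp
    split_ifs with hS
    · obtain ⟨m, hm, h⟩ := hcov S hS
      refine le_trans (le_of_eq ?_) (Finset.single_le_sum hnn hm)
      rw [if_pos h]
    · exact Finset.sum_nonneg hnn
  calc t * ∑ S with t ≤ topCost Λ S, (l.alloc S).toReal
      ≤ t * ∑ i ∈ Mn, l.price / (t / k) := by gcongr; exact hsum.trans (Finset.sum_le_sum hhit)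
    _ = Mn.card * (k * l.price) := by rw [Finset.sum_const, nsmul_eq_mul]; field_simp
    _ ≤ k * (k * l.price) := by gcongr
    _ = _ := by ring

end AcquisitionCost

/-! ### The averaging argument over the scales of the prices -/

/-- The numerical core of the upper bound. Here `x` is the allocation of the lottery that the buyer
purchases at price `p`, `V S` is her value for the bundle `S`, `Q S` is the cost of (the maximal
items of) `S` at the acquisition costs, `w j` is the
optimal utility of the buyer and `ρ j` her payment when all acquisition costs are scaled by
`2⁻ʲ`. -/
lemma price_le_weighted_sum {Ω : Type} [Fintype Ω] (x V Q : Ω → ℝ) (hx : ∀ S, 0 ≤ x S)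
    (hx1 : ∑ S, x S = 1) {p K : ℝ} (hp : 0 ≤ p) (hK : 0 < K)
    (htail : ∀ t : ℝ, 0 < t → t * ∑ S with t ≤ Q S, x S ≤ K * p)
    (w ρ : ℕ → ℝ) (hρ : ∀ j, 0 ≤ ρ j) (hw : ∀ j, w (j + 1) ≤ w j + ρ (j + 1))
    (hV : ∀ S, x S ≠ 0 → ∀ j, V S ≤ w j + (1 / 2) ^ j * Q S)
    (h0 : w 0 + p ≤ ∑ S, x S * V S) {J : ℕ} (hJ : 4 * K ≤ 2 ^ J) :
    ∃ N, 3 / 4 * p ≤ ∑ j ∈ Finset.range J, ρ (j + 1)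
      + ∑ i ∈ Finset.range N, (1 / 2) ^ i * (ρ (J + 2 * i + 1) + ρ (J + 2 * i + 2)) := by
  rcases hp.eq_or_lt with rfl | hp
  · exact ⟨0, by simpa using Finset.sum_nonneg fun j _ => hρ _⟩
  -- `m S` is the least `m` with `Q S ≤ 2 ^ m * K * p`
  have hex : ∀ S, ∃ m : ℕ, Q S ≤ 2 ^ m * (K * p) := fun S => by
    obtain ⟨m, hm⟩ := pow_unbounded_of_one_lt (Q S / (K * p)) (one_lt_two : (1 : ℝ) < 2)
    exact ⟨m, ((div_lt_iff₀ (by positivity)).1 hm).le⟩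
  classical
  set m : Ω → ℕ := fun S => Nat.find (hex S) with hm
  have hm1 : ∀ S, Q S ≤ 2 ^ m S * (K * p) := fun S => Nat.find_spec (hex S)
  have hm2 : ∀ S i, i < m S → 2 ^ i * (K * p) ≤ Q S := fun S i hi =>
    (not_le.1 (Nat.find_min (hex S) hi)).le
  set N := Finset.univ.sup m with hN
  refine ⟨N, ?_⟩
  set b : ℕ → ℝ := fun i => ρ (J + 2 * i + 1) + ρ (J + 2 * i + 2) with hb
  have hb0 : ∀ i, 0 ≤ b i := fun i => add_nonneg (hρ _) (hρ _)
  have hwJ : ∀ j, w j ≤ w 0 + ∑ i ∈ Finset.range j, ρ (i + 1) := fun j => by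
    induction j with
    | zero => simp
    | succ j ih => rw [Finset.sum_range_succ]; linarith [hw j]
  have hwm : ∀ n, w (J + 2 * n) ≤ w J + ∑ i ∈ Finset.range n, b i := fun n => by
    induction n with
    | zero => simp
    | succ n ih =>
      rw [Finset.sum_range_succ]
      have h1 := hw (J + 2 * n)
      have h2 := hw (J + 2 * n + 1)
      have h3 : J + 2 * (n + 1) = J + 2 * n + 1 + 1 := by ring
      rw [h3]
      simp only [hb]
      linarith
  -- evaluate the bound on `V S` at the scale `J + 2 * m S`
  have hVS : ∀ S, x S ≠ 0 →
      V S ≤ w J + p / 4 + ∑ i ∈ Finset.range N, if i < m S then b i else 0 := by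
    intro S hS
    have h1 := hV S hS (J + 2 * m S)
    have h2 : (1 / 2 : ℝ) ^ (J + 2 * m S) * Q S ≤ p / 4 := by
      have hJ' : (1 / 2 : ℝ) ^ J * (4 * K) ≤ 1 := by
        rw [one_div, inv_pow, inv_mul_le_iff₀ (by positivity), mul_one]; exact hJ
      have h3 : (1 / 2 : ℝ) ^ m S * 2 ^ m S = 1 := by rw [← mul_pow]; norm_num
      have h4 : (1 / 2 : ℝ) ^ m S ≤ 1 := pow_le_one₀ (by norm_num) (by norm_num)
      have h5 : (0 : ℝ) ≤ (1 / 2 : ℝ) ^ m S := by positivity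
      calc (1 / 2 : ℝ) ^ (J + 2 * m S) * Q S
          ≤ (1 / 2 : ℝ) ^ (J + 2 * m S) * (2 ^ m S * (K * p)) := by gcongr; exact hm1 S
        _ = ((1 / 2 : ℝ) ^ m S * 2 ^ m S) * (1 / 2 : ℝ) ^ m S * ((1 / 2 : ℝ) ^ J * (4 * K))
              * (p / 4) := by ring
        _ ≤ 1 * 1 * 1 * (p / 4) := by rw [h3]; gcongr
        _ = p / 4 := by ring
    have h3 : ∑ i ∈ Finset.range N, (if i < m S then b i else 0)
        = ∑ i ∈ Finset.range (m S), b i := by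
      rw [← Finset.sum_filter]
      congr 1
      ext i
      have : m S ≤ N := Finset.le_sup (f := m) (Finset.mem_univ S)
      simp only [Finset.mem_filter, Finset.mem_range]
      omega
    rw [h3]
    linarith [hwm (m S)]
  -- the scales beyond `J + 2 * i` are reached only by bundles of cost at least `2 ^ i * K * p`
  have hmass : ∀ i, ∑ S with i < m S, x S ≤ (1 / 2) ^ i := by
    intro i
    have h1 := htail (2 ^ i * (K * p)) (by positivity)
    have h2 : ∑ S with i < m S, x S ≤ ∑ S with 2 ^ i * (K * p) ≤ Q S, x S :=
      Finset.sum_le_sum_of_subset_of_nonneg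
        (Finset.monotone_filter_right _ fun S _ hS => hm2 S i hS) fun _ _ _ => hx _
    have h3 : 2 ^ i * ∑ S with 2 ^ i * (K * p) ≤ Q S, x S ≤ 1 := by
      have : 0 < K * p := by positivity
      refine le_of_mul_le_mul_right ?_ this
      linarith
    rw [one_div, inv_pow, ← one_div, le_div_iff₀ (by positivity)]
    nlinarith [pow_pos (two_pos : (0 : ℝ) < 2) i]
  have hmain : ∑ S, x S * V S
      ≤ w J + p / 4 + ∑ i ∈ Finset.range N, (1 / 2) ^ i * b i := by
    calc ∑ S, x S * V S
        ≤ ∑ S, x S * (w J + p / 4 + ∑ i ∈ Finset.range N, if i < m S then b i else 0) := by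
          refine Finset.sum_le_sum fun S _ => ?_
          by_cases hS : x S = 0
          · simp [hS]
          · exact mul_le_mul_of_nonneg_left (hVS S hS) (hx S)
      _ = w J + p / 4 + ∑ i ∈ Finset.range N, (∑ S with i < m S, x S) * b i := by
          simp only [mul_add, Finset.sum_add_distrib, ← Finset.sum_mul, hx1, one_mul,
            Finset.mul_sum]
          rw [Finset.sum_comm]
          congr 1
          refine Finset.sum_congr rfl fun i _ => ?_
          rw [Finset.sum_filter, Finset.sum_mul]
          refine Finset.sum_congr rfl fun S _ => ?_
          split_ifs <;> simp
      _ ≤ _ := by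
          gcongr with i _
          · exact hb0 i
          · exact hmass i
  linarith [hwJ J]

/-! ### Payments under item pricings -/

section ItemPricing

variable {ι : Type} [Fintype ι]

lemma utility_pure (v : Valuation ι) (S : Finset ι) (c : ℝ≥0) :
    utility v ⟨PMF.pure S, c⟩ = (v S : ℝ) - c := by
  unfold utility
  rw [Finset.sum_eq_single S (fun T _ hT => by simp [PMF.pure_apply, hT]) (by simp)]
  simp

open Classical in
lemma payment_itemMenu (r : ι → ℝ≥0) (v : Valuation ι) :
    payment (itemMenu r) v = ⨆ S : Finset ι,
      if ∀ S' : Finset ι, (v S' : ℝ) - ((∑ i ∈ S', r i : ℝ≥0) : ℝ)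
          ≤ v S - ((∑ i ∈ S, r i : ℝ≥0) : ℝ)
      then ((∑ i ∈ S, r i : ℝ≥0) : ℝ≥0∞) else 0 := by
  unfold payment itemMenu
  apply le_antisymm
  · refine iSup₂_le ?_
    rintro _ ⟨⟨S, rfl⟩, hS⟩
    refine le_iSup_of_le S ?_
    rw [if_pos]
    intro S'
    simpa only [utility_pure] using hS _ ⟨S', rfl⟩
  · refine iSup_le fun S => ?_
    split_ifs with hS
    · refine le_iSup₂_of_le ⟨PMF.pure S, ∑ i ∈ S, r i⟩ ⟨⟨S, rfl⟩, ?_⟩ le_rfl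
      rintro _ ⟨S', rfl⟩
      simpa only [utility_pure] using hS S'
    · exact zero_le

lemma measurable_payment_itemMenu (r : ι → ℝ≥0) :
    Measurable fun v : Valuation ι => payment (itemMenu r) v := by
  classical
  simp only [payment_itemMenu]
  refine Measurable.iSup fun S => Measurable.ite ?_ measurable_const measurable_const
  simp only [Set.ofPred_forall]
  refine MeasurableSet.iInter fun S' => measurableSet_le ?_ ?_
  · exact (measurable_coe_nnreal_real.comp (measurable_pi_apply S')).sub_const _
  · exact (measurable_coe_nnreal_real.comp (measurable_pi_apply S)).sub_const _

lemma le_payment_itemMenu {r : ι → ℝ≥0} {v : Valuation ι} {T : Finset ι}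
    (hT : ∀ S : Finset ι, (v S : ℝ) - ∑ i ∈ S, (r i : ℝ) ≤ v T - ∑ i ∈ T, (r i : ℝ)) :
    ((∑ i ∈ T, r i : ℝ≥0) : ℝ≥0∞) ≤ payment (itemMenu r) v := by
  classical
  rw [payment_itemMenu]
  refine le_iSup_of_le T ?_
  rw [if_pos]
  intro S
  simpa using hT S

end ItemPricing

/-! ### The upper bound -/

section UpperBound

variable {ι : Type} [Fintype ι] [PartialOrder ι]

open Classical in
/-- The acquisition costs, scaled by `2⁻ʲ`. Items that the menu never allocates get the price `M`
at every scale. -/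
noncomputable def scaledPrice (Λ : Set (Lottery ι)) (M : ℝ≥0) (j : ℕ) (i : ι) : ℝ≥0 :=
  if acquisitionCost Λ i = ⊤ then M else (1 / 2) ^ j * (acquisitionCost Λ i).toNNReal

omit [Fintype ι] in
lemma sum_scaledPrice {Λ : Set (Lottery ι)} {M : ℝ≥0} (j : ℕ) {T : Finset ι}
    (hT : ∀ i ∈ T, acquisitionCost Λ i ≠ ⊤) :
    ∑ i ∈ T, (scaledPrice Λ M j i : ℝ)
      = (1 / 2) ^ j * ∑ i ∈ T, (acquisitionCost Λ i).toReal := by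
  rw [Finset.mul_sum]
  refine Finset.sum_congr rfl fun i hi => ?_
  simp [scaledPrice, hT i hi, ENNReal.toReal]

/-- The total payment over all scales, with the weights of `price_le_weighted_sum`. -/
noncomputable def weightedPayment (Λ : Set (Lottery ι)) (M : ℝ≥0) (J : ℕ) (v : Valuation ι) :
    ℝ≥0∞ :=
  2 * (∑ j ∈ Finset.range J, payment (itemMenu (scaledPrice Λ M (j + 1))) v
    + ∑' i : ℕ, 2⁻¹ ^ i * (payment (itemMenu (scaledPrice Λ M (J + 2 * i + 1))) v
      + payment (itemMenu (scaledPrice Λ M (J + 2 * i + 2))) v))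

variable [DecidableEq ι]

/-- Pointwise in the type of the buyer, her payment in a buy-many menu is bounded by her payments
under the scaled acquisition costs. -/
lemma payment_le_weightedPayment {Λ : Set (Lottery ι)} (hΛ : IsBuyMany Λ) {v : Valuation ι}
    (hv : Monotone v) (hpo : IsPartiallyOrdered v) {M : ℝ≥0} (hM : v Finset.univ < M)
    {k : ℝ} (hk : 1 ≤ k) (hw : (width ι : ℝ) ≤ k) {J : ℕ} (hJ : 4 * k ^ 2 ≤ 2 ^ J) :
    payment Λ v ≤ weightedPayment Λ M J v := by
  refine iSup₂_le ?_
  rintro l ⟨hl, hmax⟩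
  have hex : ∀ j, ∃ T : Finset ι, ∀ S : Finset ι,
      (v S : ℝ) - ∑ i ∈ S, (scaledPrice Λ M j i : ℝ)
        ≤ v T - ∑ i ∈ T, (scaledPrice Λ M j i : ℝ) :=
    fun j => Finite.exists_max fun S : Finset ι => (v S : ℝ) - ∑ i ∈ S, (scaledPrice Λ M j i : ℝ)
  choose T hT using hex
  -- a bundle with an unavailable item costs more than it is worth
  have havail : ∀ j, ∀ i ∈ T j, acquisitionCost Λ i ≠ ⊤ := by
    intro j i hi hi'
    have h1 := hT j ∅
    have h2 : (scaledPrice Λ M j i : ℝ) ≤ ∑ i ∈ T j, (scaledPrice Λ M j i : ℝ) :=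
      Finset.single_le_sum (f := fun i => (scaledPrice Λ M j i : ℝ))
        (fun i _ => NNReal.coe_nonneg _) hi
    have h3 : scaledPrice Λ M j i = M := by simp [scaledPrice, hi']
    have h4 : (v (T j) : ℝ) < M := by
      exact_mod_cast lt_of_le_of_lt (hv (Finset.subset_univ _)) hM
    have h5 : (0 : ℝ) ≤ v ∅ := NNReal.coe_nonneg _
    rw [h3] at h2
    simp only [Finset.sum_empty, sub_zero] at h1
    linarith
  set ρ : ℕ → ℝ≥0 := fun j => ∑ i ∈ T j, scaledPrice Λ M j i with hρ
  set w : ℕ → ℝ := fun j => (v (T j) : ℝ) - ρ j with hwdef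
  have hwT : ∀ j (S : Finset ι), (∀ i ∈ S, acquisitionCost Λ i ≠ ⊤) →
      (v S : ℝ) ≤ w j + (1 / 2) ^ j * ∑ i ∈ S, (acquisitionCost Λ i).toReal := by
    intro j S hS
    have h1 := hT j S
    rw [sum_scaledPrice j hS] at h1
    simp only [hwdef, hρ, NNReal.coe_sum]
    linarith
  have hρ' : ∀ j, (ρ j : ℝ) = (1 / 2) ^ j * ∑ i ∈ T j, (acquisitionCost Λ i).toReal := fun j => by
    rw [← sum_scaledPrice (M := M) j (havail j)]
    simp [hρ]
  have hstep : ∀ j, w (j + 1) ≤ w j + ρ (j + 1) := by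
    intro j
    have h1 := hwT j (T (j + 1)) (havail (j + 1))
    have h2 := hρ' (j + 1)
    have h3 : (1 / 2 : ℝ) ^ j * ∑ i ∈ T (j + 1), (acquisitionCost Λ i).toReal
        = 2 * ρ (j + 1) := by rw [h2, pow_succ]; ring
    have h4 : w (j + 1) = (v (T (j + 1)) : ℝ) - ρ (j + 1) := rfl
    linarith
  -- the buyer could acquire `T 0` from the menu, so she does at least as well with `l`
  have hw0 : w 0 ≤ utility v l := by
    refine le_of_forall_pos_sub_le fun ε hε => ?_
    obtain ⟨l', hl', hu⟩ := exists_utility_ge hΛ hv hpo (havail 0) hε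
    have h2 := hρ' 0
    rw [pow_zero, one_mul] at h2
    have h3 : w 0 = (v (T 0) : ℝ) - ρ 0 := rfl
    linarith [hmax l' hl']
  have hV : ∀ S, (l.alloc S).toReal ≠ 0 → ∀ j, (v S : ℝ) ≤ w j + (1 / 2) ^ j * topCost Λ S := by
    intro S hS j
    have hS' : l.alloc S ≠ 0 := fun h => hS (by simp [h])
    have h1 : v S ≤ v (topItems S) :=
      le_of_forall_exists_le hv hpo fun i hi => exists_topItems_ge hi
    have h2 : ∀ i ∈ topItems S, acquisitionCost Λ i ≠ ⊤ := fun i hi =>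
      acquisitionCost_ne_top hl (hitProb_ne_zero hS' (topItems_subset S hi) le_rfl)
    exact le_trans (by exact_mod_cast h1) (hwT j _ h2)
  classical
  obtain ⟨N, hN⟩ := price_le_weighted_sum (fun S => (l.alloc S).toReal) (fun S => (v S : ℝ))
    (topCost Λ) (fun _ => ENNReal.toReal_nonneg) (sum_toReal_eq_one _) (p := l.price)
    (K := k ^ 2) l.price.coe_nonneg (by positivity) (fun t ht => topCost_tail hl hk hw ht) w
    (fun j => ρ j) (fun _ => NNReal.coe_nonneg _) hstep hV
    (by unfold utility at hw0; linarith) hJ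
  have hle : ∀ j, (ρ j : ℝ≥0∞) ≤ payment (itemMenu (scaledPrice Λ M j)) v := fun j =>
    le_payment_itemMenu (hT j)
  have hN' : l.price ≤ 2 * (∑ j ∈ Finset.range J, ρ (j + 1)
      + ∑ i ∈ Finset.range N, 2⁻¹ ^ i * (ρ (J + 2 * i + 1) + ρ (J + 2 * i + 2))) := by
    rw [← NNReal.coe_le_coe]
    push_cast
    simp only [one_div] at hN
    have : (0 : ℝ) ≤ l.price := l.price.coe_nonneg
    linarith
  calc (l.price : ℝ≥0∞)
      ≤ ((2 * (∑ j ∈ Finset.range J, ρ (j + 1) + ∑ i ∈ Finset.range N,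
          2⁻¹ ^ i * (ρ (J + 2 * i + 1) + ρ (J + 2 * i + 2))) : ℝ≥0) : ℝ≥0∞) := by
        exact_mod_cast hN'
    _ = 2 * (∑ j ∈ Finset.range J, (ρ (j + 1) : ℝ≥0∞) + ∑ i ∈ Finset.range N,
          2⁻¹ ^ i * ((ρ (J + 2 * i + 1) : ℝ≥0∞) + ρ (J + 2 * i + 2))) := by
        push_cast
        rfl
    _ ≤ 2 * (∑ j ∈ Finset.range J, payment (itemMenu (scaledPrice Λ M (j + 1))) v
          + ∑ i ∈ Finset.range N, 2⁻¹ ^ i *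
            (payment (itemMenu (scaledPrice Λ M (J + 2 * i + 1))) v
              + payment (itemMenu (scaledPrice Λ M (J + 2 * i + 2))) v)) := by
        gcongr <;> exact hle _
    _ ≤ weightedPayment Λ M J v := by
        unfold weightedPayment
        gcongr
        exact ENNReal.sum_le_tsum _

omit [DecidableEq ι] in
lemma lintegral_weightedPayment_le (D : Measure (Valuation ι)) (Λ : Set (Lottery ι)) (M : ℝ≥0)
    (J : ℕ) : ∫⁻ v, weightedPayment Λ M J v ∂D ≤ 2 * (J + 4) * itemRev D := by
  have hmeas := fun j => measurable_payment_itemMenu (scaledPrice Λ M j)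
  have hrev : ∀ j, ∫⁻ v, payment (itemMenu (scaledPrice Λ M j)) v ∂D ≤ itemRev D := fun j =>
    le_iSup (fun p => revenue D (itemMenu p)) (scaledPrice Λ M j)
  have hmeas2 : ∀ i : ℕ, Measurable fun v => (2⁻¹ : ℝ≥0∞) ^ i *
      (payment (itemMenu (scaledPrice Λ M (J + 2 * i + 1))) v
        + payment (itemMenu (scaledPrice Λ M (J + 2 * i + 2))) v) := fun i =>
    ((hmeas _).add (hmeas _)).const_mul _
  have hmeas1 : Measurable fun v =>
      ∑ j ∈ Finset.range J, payment (itemMenu (scaledPrice Λ M (j + 1))) v :=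
    Finset.measurable_fun_sum _ fun j _ => hmeas _
  unfold weightedPayment
  rw [lintegral_const_mul _ (by exact hmeas1.add (Measurable.tsum hmeas2)),
    lintegral_add_left hmeas1,
    lintegral_finsetSum _ (fun j _ => hmeas _),
    lintegral_tsum fun i => (hmeas2 i).aemeasurable, mul_assoc]
  gcongr
  rw [add_mul]
  gcongr
  · calc _ ≤ ∑ j ∈ Finset.range J, itemRev D := Finset.sum_le_sum fun j _ => hrev _
      _ = _ := by simp
  · calc _ ≤ ∑' i : ℕ, (2⁻¹ : ℝ≥0∞) ^ i * (itemRev D + itemRev D) := by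
          refine ENNReal.tsum_le_tsum fun i => ?_
          rw [lintegral_const_mul _ (by exact (hmeas _).add (hmeas _)), lintegral_add_left (hmeas _)]
          gcongr <;> exact hrev _
      _ = 4 * itemRev D := by
          rw [ENNReal.tsum_mul_right, ENNReal.tsum_geometric, ENNReal.one_sub_inv_two, inv_inv]
          ring

lemma clog_two_le (k : ℕ) (hk : 1 ≤ k) : (Nat.clog 2 k : ℝ) ≤ 1 + 2 * Real.log k := by
  rcases hk.eq_or_lt with rfl | hk'
  · simp
  have h1 : 2 ^ (Nat.clog 2 k).pred < k := Nat.pow_pred_clog_lt_self one_lt_two hk'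
  have h2 : ((Nat.clog 2 k).pred : ℝ) * Real.log 2 ≤ Real.log k := by
    rw [← Real.log_pow]
    refine Real.log_le_log (by positivity) ?_
    exact_mod_cast h1.le
  have h3 : (Nat.clog 2 k : ℝ) ≤ (Nat.clog 2 k).pred + 1 := by
    exact_mod_cast Nat.le_succ_of_pred_le le_rfl
  have h4 := Real.log_two_gt_d9
  have h5 : (0 : ℝ) ≤ (Nat.clog 2 k).pred := Nat.cast_nonneg _
  nlinarith

/-- For partially ordered valuations over items of width at most `k`, item pricing is an
`O(1 + log k)`-approximation to every buy-many menu. -/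
theorem buyManyRev_le_of_one_le (D : Measure (Valuation ι))
    (hD : ∀ᵐ v ∂D, Monotone v ∧ IsPartiallyOrdered v) {k : ℕ} (hk : 1 ≤ k) (hw : width ι ≤ k) :
    buyManyRev D ≤ ENNReal.ofReal (16 * (1 + Real.log k)) * itemRev D := by
  have hlog : 0 ≤ Real.log k := Real.log_nonneg (by exact_mod_cast hk)
  set J := 2 * Nat.clog 2 k + 2 with hJ
  have hkJ : (4 * (k : ℝ) ^ 2) ≤ 2 ^ J := by
    have h1 : k ≤ 2 ^ Nat.clog 2 k := Nat.le_pow_clog one_lt_two k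
    have h2 : (k : ℝ) ≤ 2 ^ Nat.clog 2 k := by exact_mod_cast h1
    calc (4 * (k : ℝ) ^ 2) ≤ 4 * (2 ^ Nat.clog 2 k) ^ 2 := by gcongr
      _ = 2 ^ J := by rw [hJ]; ring
  refine iSup₂_le fun Λ hΛ => ?_
  -- the price of the unavailable items must exceed all values, so bounded valuations come first
  set s : ℕ → Set (Valuation ι) := fun n => {v | v Finset.univ < n} with hs
  have hsU : ⋃ n, s n = Set.univ := by
    refine Set.eq_univ_of_forall fun v => Set.mem_iUnion.2 ?_
    exact exists_nat_gt (v Finset.univ)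
  have hdir : Directed (· ⊆ ·) s := by
    have hmono : ∀ a b, a ≤ b → s a ⊆ s b := by
      intro a b hab v hv
      simp only [hs, Set.mem_ofPred_eq] at hv ⊢
      exact lt_of_lt_of_le hv (by exact_mod_cast hab)
    exact fun a b => ⟨max a b, hmono _ _ (le_max_left _ _), hmono _ _ (le_max_right _ _)⟩
  unfold revenue
  rw [← setLIntegral_univ, ← hsU, setLIntegral_iUnion_of_directed _ hdir]
  refine iSup_le fun n => ?_
  have hmeas : MeasurableSet (s n) := measurableSet_lt (measurable_pi_apply _) measurable_const
  calc ∫⁻ v in s n, payment Λ v ∂D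
      ≤ ∫⁻ v in s n, weightedPayment Λ n J v ∂D := by
        refine setLIntegral_mono_ae' hmeas ?_
        filter_upwards [hD] with v hv hvn
        exact payment_le_weightedPayment hΛ hv.1 hv.2 hvn (by exact_mod_cast hk)
          (by exact_mod_cast hw) hkJ
    _ ≤ ∫⁻ v, weightedPayment Λ n J v ∂D := setLIntegral_le_lintegral _ _
    _ ≤ 2 * (J + 4) * itemRev D := lintegral_weightedPayment_le D Λ n J
    _ ≤ _ := by
        gcongr
        have h1 : (2 * (J + 4) : ℝ≥0∞) = ENNReal.ofReal (2 * (J + 4)) := by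
          rw [ENNReal.ofReal_mul (by norm_num), ENNReal.ofReal_add (by positivity) (by norm_num)]
          simp
        rw [h1]
        refine ENNReal.ofReal_le_ofReal ?_
        have h2 := clog_two_le k hk
        simp only [hJ]
        push_cast
        linarith

/-- The case `k = 0` is that of no items, where `Real.log 0 = 0`. -/
theorem buyManyRev_le (D : Measure (Valuation ι))
    (hD : ∀ᵐ v ∂D, Monotone v ∧ IsPartiallyOrdered v) {k : ℕ} (hw : width ι ≤ k) :
    buyManyRev D ≤ ENNReal.ofReal (16 * (1 + Real.log k)) * itemRev D := by
  rcases Nat.eq_zero_or_pos k with rfl | hk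
  · simpa using buyManyRev_le_of_one_le D hD le_rfl (hw.trans zero_le_one)
  · exact buyManyRev_le_of_one_le D hD hk hw

end UpperBound

/-! ### Categories and totally ordered items as partial orders -/

section SpecialOrders

lemma width_categoryItem_le {k : ℕ} (m : Fin k → ℕ) : width (CategoryItem m) ≤ k := by
  classical
  refine Finset.sup_le fun A hA => ?_
  have hA' : IsAntichain (· ≤ ·) (A : Set (CategoryItem m)) := by simpa using hA
  have hinj : Set.InjOn (Sigma.fst : CategoryItem m → Fin k) A := by
    rintro ⟨a, x⟩ hx ⟨b, y⟩ hy (rfl : a = b)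
    rcases le_total x y with h | h
    · exact hA'.eq hx hy (Sigma.mk_le_mk_iff.2 h)
    · exact (hA'.eq hy hx (Sigma.mk_le_mk_iff.2 h)).symm
  simpa using Finset.card_le_card_of_injOn Sigma.fst (fun _ _ => Finset.mem_univ _) hinj

lemma IsCategoryValuation.isPartiallyOrdered {k : ℕ} {m : Fin k → ℕ}
    {v : Valuation (CategoryItem m)} (hv : IsCategoryValuation v) : IsPartiallyOrdered v := by
  rintro _ _ ⟨a, x, y, hxy⟩ S
  refine hv _ _ fun b => le_antisymm ?_ ?_
  · refine Finset.max_le fun z hz => ?_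
    simp only [Finset.mem_filter, Finset.mem_univ, true_and, Finset.mem_union, Finset.mem_insert,
      Finset.mem_singleton] at hz
    have hmem : ∀ z', (⟨b, z'⟩ : CategoryItem m) ∈ S ∪ {⟨a, y⟩} →
        (z' : WithBot (Fin (m b))) ≤ bestItem (S ∪ {⟨a, y⟩}) b := fun z' hz' =>
      Finset.le_max (by simpa using hz')
    rcases hz with hz | hz | hz
    · exact hmem z (Finset.mem_union_left _ hz)
    · obtain ⟨rfl, hz⟩ := Sigma.mk.inj_iff.1 hz
      obtain rfl := eq_of_heq hz
      exact (WithBot.coe_le_coe.2 hxy).trans (hmem y (by simp))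
    · exact hmem z (by simp [hz])
  · refine Finset.max_mono (Finset.monotone_filter_right _ fun z _ hz => ?_)
    simp only [Finset.mem_union, Finset.mem_insert, Finset.mem_singleton] at hz ⊢
    tauto

lemma width_fin_le (n : ℕ) : width (Fin n) ≤ 1 := by
  classical
  refine Finset.sup_le fun A hA => ?_
  have hA' : IsAntichain (· ≤ ·) (A : Set (Fin n)) := by simpa using hA
  refine Finset.card_le_one.2 fun x hx y hy => ?_
  rcases le_total x y with h | h
  · exact hA'.eq hx hy h
  · exact (hA'.eq hy hx h).symm

lemma IsTotallyOrdered.monotone {n : ℕ} {v : Valuation (Fin n)} (hv : IsTotallyOrdered v) :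
    Monotone v := fun S T h => by
  rw [hv.1 S, hv.1 T]
  exact Finset.sup_mono h

lemma IsTotallyOrdered.isPartiallyOrdered {n : ℕ} {v : Valuation (Fin n)}
    (hv : IsTotallyOrdered v) : IsPartiallyOrdered v := fun i j hij S => by
  rw [hv.1 (S ∪ {i, j}), hv.1 (S ∪ {j})]
  simp only [Finset.sup_union, Finset.sup_insert, Finset.sup_singleton]
  rw [sup_eq_right.2 (hv.2 hij)]

end SpecialOrders

/-! ### Menus without surplus -/

section SurplusFree

variable {ι : Type} [Fintype ι] [DecidableEq ι]

/-- The menu of all lotteries whose price is at least their value for every valuation in `𝒱`. -/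
def surplusFreeMenu (𝒱 : Set (Valuation ι)) : Set (Lottery ι) :=
  {l | ∀ v ∈ 𝒱, expect l.alloc (fun S => v S) ≤ l.price}

/-- For subadditive valuations an adaptive algorithm that buys lotteries without surplus pays at
least the value of what it obtains, so its outcome is again a lottery without surplus. -/
lemma isBuyMany_surplusFreeMenu {𝒱 : Set (Valuation ι)} (h0 : ∀ v ∈ 𝒱, v ∅ = 0)
    (hsub : ∀ v ∈ 𝒱, ∀ S T, v (S ∪ T) ≤ v S + v T) {M : ℝ≥0} (hM : ∀ v ∈ 𝒱, ∀ S, v S ≤ M) :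
    IsBuyMany (surplusFreeMenu 𝒱) := by
  intro A hA
  obtain ⟨μ, hμ⟩ := exists_limit_law A
  -- an algorithm with infinite payment is dominated by all items at the price `M`
  by_cases htop : expectedPayment A = ⊤
  · refine ⟨⟨PMF.pure Finset.univ, M⟩, fun v hv => ?_, by simp [htop],
      μ.map fun T => (Finset.univ, T), ?_, fun T => ?_, ?_⟩
    · rw [expect_pure]
      exact_mod_cast hM v hv _
    · rw [PMF.map_comp]
      exact PMF.map_const _ _
    · rw [PMF.map_comp]
      have : (μ.map (Prod.snd ∘ fun T => ((Finset.univ : Finset ι), T))) = μ := PMF.map_id μ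
      rw [this]
      exact hμ T
    · intro z hz
      obtain ⟨T, -, rfl⟩ := (PMF.mem_support_map_iff _ _ _).1 hz
      exact Finset.subset_univ _
  · refine ⟨⟨μ, (expectedPayment A).toNNReal⟩, fun v hv => ?_, ?_,
      μ.map fun T => (T, T), ?_, fun T => ?_, ?_⟩
    · rw [ENNReal.coe_toNNReal htop]
      have hlim : Tendsto (fun t => expect ((history A t).map bundle) fun S => (v S : ℝ≥0∞))
          atTop (𝓝 (expect μ fun S => (v S : ℝ≥0∞))) := by
        simp only [expect, tsum_fintype]
        exact tendsto_finsetSum _ fun T _ =>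
          ENNReal.Tendsto.mul_const (hμ T) (Or.inr ENNReal.coe_ne_top)
      refine le_of_tendsto' hlim fun t => ?_
      rw [expect_map]
      refine expect_history_le_expectedPayment A (fun h => (v (bundle h) : ℝ≥0∞)) ?_ ?_ t
      · simp [bundle, h0 v hv]
      · intro h
        cases hAh : A h with
        | none => rw [nextExpect_none _ hAh]; exact le_self_add
        | some l =>
          rw [nextExpect_some _ hAh]
          have hnext : nextPrice A h = l.price := by simp [nextPrice, hAh]
          rw [hnext, add_comm]
          calc expect l.alloc (fun S => (v (bundle (S :: h)) : ℝ≥0∞))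
              ≤ expect l.alloc (fun S => (v S : ℝ≥0∞) + v (bundle h)) :=
                expect_mono _ fun S => by exact_mod_cast hsub v hv S (bundle h)
            _ ≤ l.price + v (bundle h) := by
                rw [expect_add, expect_const]
                gcongr
                exact hA h l hAh v hv
    · rw [ENNReal.coe_toNNReal htop]
    · rw [PMF.map_comp]
      exact PMF.map_id μ
    · rw [PMF.map_comp]
      have : (μ.map (Prod.snd ∘ fun T : Finset ι => (T, T))) = μ := PMF.map_id μ
      rw [this]
      exact hμ T
    · intro z hz
      obtain ⟨T, -, rfl⟩ := (PMF.mem_support_map_iff _ _ _).1 hz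
      exact subset_rfl

omit [DecidableEq ι] in
lemma utility_nonpos_of_mem_surplusFreeMenu {𝒱 : Set (Valuation ι)} {v : Valuation ι}
    (hv : v ∈ 𝒱) {l : Lottery ι} (hl : l ∈ surplusFreeMenu 𝒱) : utility v l ≤ 0 := by
  have h1 := ENNReal.toReal_le_of_le_ofReal l.price.coe_nonneg
    (by simpa using hl v hv : expect l.alloc (fun S => v S) ≤ ENNReal.ofReal l.price)
  rw [expect, tsum_fintype, ENNReal.toReal_sum fun S _ =>
    ENNReal.mul_ne_top (l.alloc.apply_ne_top S) ENNReal.coe_ne_top] at h1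
  simp only [ENNReal.toReal_mul, ENNReal.coe_toReal] at h1
  unfold utility
  linarith

omit [DecidableEq ι] in
lemma revenue_smul (c : ℝ≥0∞) (D : Measure (Valuation ι)) (Λ : Set (Lottery ι)) :
    revenue (c • D) Λ = c * revenue D Λ := by
  simp [revenue, lintegral_smul_measure]

end SurplusFree

/-! ### A family of almost disjoint bundles separates the two revenues -/

/-- The sum starts at the first `j` with `y ≤ 2 ^ j`, where the term is at most `1`, and is geometric
from there on. -/
lemma sum_range_geometric_le (L : ℕ) (y : ℝ≥0) :
    ∑ j ∈ Finset.range L, 2⁻¹ ^ j * (if y ≤ 2 ^ j then y else 0) ≤ 2 := by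
  -- the second summand is the rest of the geometric series, or all of `2` before the sum starts
  have key : ∑ j ∈ Finset.range L, 2⁻¹ ^ j * (if y ≤ 2 ^ j then y else 0)
      + 2 * (2⁻¹ ^ L * min y (2 ^ L)) ≤ 2 := by
    have hinv : ∀ n : ℕ, (2⁻¹ : ℝ≥0) ^ n * 2 ^ n = 1 := fun n => by
      rw [← mul_pow, inv_mul_cancel₀ two_ne_zero, one_pow]
    induction L with
    | zero => simp
    | succ L ih =>
      rw [Finset.sum_range_succ]
      have hpow : 2 * ((2⁻¹ : ℝ≥0) ^ (L + 1) * min y (2 ^ (L + 1)))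
          = 2⁻¹ ^ L * min y (2 ^ (L + 1)) := by
        rw [pow_succ, ← mul_assoc, mul_comm 2, mul_assoc (2⁻¹ ^ L), inv_mul_cancel₀ two_ne_zero,
          mul_one]
      rw [hpow]
      split_ifs with hy
      · rw [min_eq_left hy] at ih
        refine le_trans ?_ ih
        rw [add_assoc, two_mul]
        gcongr
        exact min_le_left _ _
      · rw [min_eq_right (not_le.1 hy).le, hinv, mul_one] at ih
        have h0 : ∑ j ∈ Finset.range L, (2⁻¹ : ℝ≥0) ^ j * (if y ≤ 2 ^ j then y else 0) = 0 := by
          refine le_antisymm ?_ zero_le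
          simpa using ih
        rw [h0, mul_zero, zero_add, zero_add]
        calc (2⁻¹ : ℝ≥0) ^ L * min y (2 ^ (L + 1)) ≤ 2⁻¹ ^ L * (2 ^ L * 2) := by
              gcongr
              rw [← pow_succ]
              exact min_le_right _ _
          _ = 2 := by rw [← mul_assoc, hinv, one_mul]
  exact le_self_add.trans key

section Separation

variable {ι : Type} [Fintype ι] [DecidableEq ι] {L : ℕ} {Θ : Type} [Fintype Θ]

/-- The additive valuation that spreads the value `2 ^ j` evenly over the `a` items of `B`. -/
noncomputable def spreadValuation (a : ℕ) (j : ℕ) (B : Finset ι) : Valuation ι := fun S =>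
  2 ^ j / a * (S ∩ B).card

omit [Fintype ι] in
lemma spreadValuation_mono (a j : ℕ) (B : Finset ι) : Monotone (spreadValuation a j B) := by
  intro S T h
  unfold spreadValuation
  gcongr

omit [Fintype ι] in
lemma spreadValuation_union_le (a j : ℕ) (B S T : Finset ι) :
    spreadValuation a j B (S ∪ T) ≤ spreadValuation a j B S + spreadValuation a j B T := by
  unfold spreadValuation
  rw [← mul_add, Finset.union_inter_distrib_right]
  gcongr
  exact_mod_cast Finset.card_union_le _ _

/-- An additive buyer purchases only items of `B` whose price is at most their value to her. -/
lemma payment_spreadValuation_le (p : ι → ℝ≥0) {a : ℕ} (ha : 0 < a) (j : ℕ) (B : Finset ι) :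
    payment (itemMenu p) (spreadValuation a j B)
      ≤ ((∑ i ∈ B, if a * p i ≤ 2 ^ j then p i else 0 : ℝ≥0) : ℝ≥0∞) := by
  classical
  rw [payment_itemMenu]
  refine iSup_le fun S => ?_
  split_ifs with hS
  swap
  · exact zero_le
  have ha' : (0 : ℝ) < a := by exact_mod_cast ha
  -- otherwise dropping `i` from the optimal bundle `S` would increase the utility
  have hitem : ∀ i ∈ S, p i ≠ 0 → i ∈ B ∧ a * p i ≤ 2 ^ j := by
    intro i hi hpi
    have h1 := hS (S.erase i)
    have h2 : ∑ x ∈ S, p x = ∑ x ∈ S.erase i, p x + p i := (Finset.sum_erase_add _ _ hi).symm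
    rw [h2] at h1
    have hpos : (0 : ℝ) < p i := by exact_mod_cast pos_iff_ne_zero.2 hpi
    by_cases hB : i ∈ B
    · refine ⟨hB, ?_⟩
      have hiSB : i ∈ S ∩ B := Finset.mem_inter.2 ⟨hi, hB⟩
      have h3 : (S.erase i ∩ B).card + 1 = (S ∩ B).card := by
        rw [Finset.erase_inter, Finset.card_erase_add_one hiSB]
      unfold spreadValuation at h1
      rw [← h3] at h1
      push_cast at h1
      have h4 : (p i : ℝ) ≤ 2 ^ j / a := by linarith
      rw [le_div_iff₀ ha'] at h4
      rw [← NNReal.coe_le_coe]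
      push_cast
      linarith
    · exfalso
      have h3 : S.erase i ∩ B = S ∩ B := by
        rw [Finset.erase_inter, Finset.erase_eq_of_notMem (by simp [hB])]
      unfold spreadValuation at h1
      rw [h3] at h1
      push_cast at h1
      linarith
  refine ENNReal.coe_le_coe.2 ?_
  calc ∑ i ∈ S, p i = ∑ i ∈ S with p i ≠ 0, p i := (Finset.sum_filter_ne_zero _).symm
    _ = ∑ i ∈ S with p i ≠ 0, if a * p i ≤ 2 ^ j then p i else 0 := by
        refine Finset.sum_congr rfl fun i hi => ?_
        rw [Finset.mem_filter] at hi
        rw [if_pos (hitem i hi.1 hi.2).2]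
    _ ≤ ∑ i ∈ B, if a * p i ≤ 2 ^ j then p i else 0 := by
        refine Finset.sum_le_sum_of_subset fun i hi => ?_
        rw [Finset.mem_filter] at hi
        exact (hitem i hi.1 hi.2).1

/-- The types are additive over bundles `A j θ` of `a` items, and the type `(j, θ)` with total
value `2 ^ j` has weight `2⁻ʲ`. -/
noncomputable def spreadMeasure (a : ℕ) (A : Fin L → Θ → Finset ι) : Measure (Valuation ι) :=
  ∑ j : Fin L, ∑ θ : Θ, (2⁻¹ : ℝ≥0∞) ^ (j : ℕ) • Measure.dirac (spreadValuation a j (A j θ))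

omit [DecidableEq ι] in
lemma lintegral_sum_smul_dirac (u : Fin L → Θ → Valuation ι) (f : Valuation ι → ℝ≥0∞) :
    ∫⁻ v, f v ∂(∑ j : Fin L, ∑ θ : Θ, (2⁻¹ : ℝ≥0∞) ^ (j : ℕ) • Measure.dirac (u j θ))
      = ∑ j : Fin L, ∑ θ : Θ, 2⁻¹ ^ (j : ℕ) * f (u j θ) := by
  rw [lintegral_finsetSum_measure]
  refine Finset.sum_congr rfl fun j _ => ?_
  rw [lintegral_finsetSum_measure]
  refine Finset.sum_congr rfl fun θ _ => ?_
  rw [lintegral_smul_measure, lintegral_dirac, smul_eq_mul]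

/-- An item of price `y` is bought only at the levels with `2 ^ j ≥ a y`, and at each level by at
most one type, so its weighted revenue is at most `2 / a`. -/
lemma itemRev_spreadMeasure_le {a : ℕ} (ha : 0 < a) (A : Fin L → Θ → Finset ι)
    (hdisj : ∀ j θ θ' i, i ∈ A j θ → i ∈ A j θ' → θ = θ') {U : Finset ι} (hU : ∀ j θ, A j θ ⊆ U)
    (hUcard : U.card = a * Fintype.card Θ) :
    itemRev (spreadMeasure a A) ≤ 2 * Fintype.card Θ := by
  refine iSup_le fun p => ?_
  unfold revenue spreadMeasure
  rw [lintegral_sum_smul_dirac]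
  set g : ℕ → ι → ℝ≥0 := fun j i => if a * p i ≤ 2 ^ j then p i else 0 with hg
  have ha' : (a : ℝ≥0) ≠ 0 := by exact_mod_cast ha.ne'
  have hNN : ∑ j : Fin L, ∑ θ : Θ, (2⁻¹ : ℝ≥0) ^ (j : ℕ) * ∑ i ∈ A j θ, g j i
      ≤ 2 * Fintype.card Θ := by
    calc ∑ j : Fin L, ∑ θ : Θ, (2⁻¹ : ℝ≥0) ^ (j : ℕ) * ∑ i ∈ A j θ, g j i
        ≤ ∑ j : Fin L, 2⁻¹ ^ (j : ℕ) * ∑ i ∈ U, g j i := by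
          refine Finset.sum_le_sum fun j _ => ?_
          rw [← Finset.mul_sum]
          gcongr
          rw [← Finset.sum_biUnion]
          · refine Finset.sum_le_sum_of_subset fun i hi => ?_
            obtain ⟨θ, -, h⟩ := Finset.mem_biUnion.1 hi
            exact hU j θ h
          · intro θ _ θ' _ hne
            exact Finset.disjoint_left.2 fun i hi hi' => hne (hdisj j θ θ' i hi hi')
      _ = ∑ i ∈ U, ∑ j ∈ Finset.range L, 2⁻¹ ^ j * g j i := by
          rw [Finset.sum_comm]
          rw [← Fin.sum_univ_eq_sum_range fun j => ∑ i ∈ U, 2⁻¹ ^ j * g j i]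
          simp only [Finset.mul_sum]
      _ ≤ ∑ i ∈ U, 2 / (a : ℝ≥0) := by
          refine Finset.sum_le_sum fun i _ => ?_
          rw [le_div_iff₀ (by positivity), Finset.sum_mul]
          refine le_trans (le_of_eq ?_) (sum_range_geometric_le L (a * p i))
          refine Finset.sum_congr rfl fun j _ => ?_
          rw [mul_assoc]
          congr 1
          simp only [hg]
          split_ifs
          · rw [mul_comm]
          · rw [zero_mul]
      _ = 2 * Fintype.card Θ := by
          rw [Finset.sum_const, nsmul_eq_mul, hUcard]
          push_cast
          field_simp
  calc ∑ j : Fin L, ∑ θ : Θ,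
        2⁻¹ ^ (j : ℕ) * payment (itemMenu p) (spreadValuation a j (A j θ))
      ≤ ∑ j : Fin L, ∑ θ : Θ, 2⁻¹ ^ (j : ℕ) * ((∑ i ∈ A j θ, g j i : ℝ≥0) : ℝ≥0∞) := by
        gcongr with j _ θ _
        exact payment_spreadValuation_le p ha j (A j θ)
    _ = ((∑ j : Fin L, ∑ θ : Θ, (2⁻¹ : ℝ≥0) ^ (j : ℕ) * ∑ i ∈ A j θ, g j i : ℝ≥0) : ℝ≥0∞) := by
        push_cast
        rfl
    _ ≤ _ := by exact_mod_cast hNN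

/-- The menu without surplus sells `A j θ` at price `2 ^ j`, since that bundle is worth at most
`2 ^ j` to all other types; so it extracts the whole welfare. -/
lemma le_buyManyRev_spreadMeasure {a : ℕ} (ha : 0 < a) (A : Fin L → Θ → Finset ι)
    (hcard : ∀ j θ, (A j θ).card = a)
    (hinter : ∀ j θ (j' : Fin L) θ',
      2 ^ (j' : ℕ) * (A j θ ∩ A j' θ').card ≤ 2 ^ (j : ℕ) * a) :
    (L : ℝ≥0∞) * Fintype.card Θ ≤ buyManyRev (spreadMeasure a A) := by
  have ha' : (a : ℝ≥0) ≠ 0 := by exact_mod_cast ha.ne'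
  set 𝒱 : Set (Valuation ι) :=
    Set.range fun x : Fin L × Θ => spreadValuation a x.1 (A x.1 x.2) with h𝒱
  have hbm : IsBuyMany (surplusFreeMenu 𝒱) := by
    refine isBuyMany_surplusFreeMenu (M := 2 ^ L) ?_ ?_ ?_
    · rintro _ ⟨x, rfl⟩
      simp [spreadValuation]
    · rintro _ ⟨x, rfl⟩ S T
      exact spreadValuation_union_le _ _ _ _ _
    · rintro _ ⟨⟨j, θ⟩, rfl⟩ S
      have h1 : ((S ∩ A j θ).card : ℝ≥0) ≤ a := by
        rw [← hcard j θ]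
        exact_mod_cast Finset.card_le_card Finset.inter_subset_right
      calc (2 ^ (j : ℕ) / a * (S ∩ A j θ).card : ℝ≥0) ≤ 2 ^ (j : ℕ) / a * a := by gcongr
        _ = 2 ^ (j : ℕ) := by field_simp
        _ ≤ 2 ^ L := pow_le_pow_right₀ one_le_two j.2.le
  refine le_trans ?_ (le_iSup₂ (f := fun Λ (_ : Λ ∈ {Λ : Set (Lottery ι) | IsBuyMany Λ}) =>
    revenue (spreadMeasure a A) Λ) (surplusFreeMenu 𝒱) hbm)
  have hpay : ∀ (j : Fin L) (θ : Θ), (2 : ℝ≥0∞) ^ (j : ℕ)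
      ≤ payment (surplusFreeMenu 𝒱) (spreadValuation a j (A j θ)) := by
    intro j θ
    have hmem : (⟨PMF.pure (A j θ), 2 ^ (j : ℕ)⟩ : Lottery ι) ∈ surplusFreeMenu 𝒱 := by
      rintro _ ⟨⟨j', θ'⟩, rfl⟩
      rw [expect_pure]
      have h1 : (2 ^ (j' : ℕ) * (A j θ ∩ A j' θ').card : ℝ≥0) ≤ 2 ^ (j : ℕ) * a := by
        exact_mod_cast hinter j θ j' θ'
      have h2 : spreadValuation a j' (A j' θ') (A j θ) ≤ 2 ^ (j : ℕ) := by
        unfold spreadValuation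
        rw [div_mul_eq_mul_div, div_le_iff₀ (by positivity)]
        exact h1
      exact_mod_cast h2
    refine le_trans (le_of_eq ?_) (le_iSup₂ (f := fun (l : Lottery ι) (_ : l ∈
      {l ∈ surplusFreeMenu 𝒱 | ∀ l' ∈ surplusFreeMenu 𝒱, utility (spreadValuation a j (A j θ)) l'
        ≤ utility (spreadValuation a j (A j θ)) l}) => (l.price : ℝ≥0∞))
      ⟨PMF.pure (A j θ), 2 ^ (j : ℕ)⟩ ⟨hmem, fun l' hl' => ?_⟩)
    · simp
    · have hv : spreadValuation a j (A j θ) ∈ 𝒱 := ⟨(j, θ), rfl⟩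
      refine (utility_nonpos_of_mem_surplusFreeMenu hv hl').trans (le_of_eq ?_)
      have h2 : spreadValuation a j (A j θ) (A j θ) = 2 ^ (j : ℕ) := by
        unfold spreadValuation
        rw [Finset.inter_self, hcard, div_mul_cancel₀ _ ha']
      rw [utility_pure, h2, sub_self]
  unfold revenue spreadMeasure
  rw [lintegral_sum_smul_dirac]
  calc (L : ℝ≥0∞) * Fintype.card Θ = ∑ j : Fin L, ∑ θ : Θ, 2⁻¹ ^ (j : ℕ) * 2 ^ (j : ℕ) := by
        simp [← mul_pow, ENNReal.inv_mul_cancel two_ne_zero ENNReal.ofNat_ne_top]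
    _ ≤ _ := by
        gcongr with j _ θ _
        exact hpay j θ

/-- The normalized instance: the buy-many revenue exceeds the item pricing revenue by a factor of at
least `L / 2`. -/
lemma exists_gap [Nonempty Θ] (hL : 0 < L) {a : ℕ} (ha : 0 < a) (A : Fin L → Θ → Finset ι)
    (hcard : ∀ j θ, (A j θ).card = a)
    (hinter : ∀ j θ (j' : Fin L) θ',
      2 ^ (j' : ℕ) * (A j θ ∩ A j' θ').card ≤ 2 ^ (j : ℕ) * a)
    (hdisj : ∀ j θ θ' i, i ∈ A j θ → i ∈ A j θ' → θ = θ') {U : Finset ι} (hU : ∀ j θ, A j θ ⊆ U)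
    (hUcard : U.card = a * Fintype.card Θ) :
    ∃ D : Measure (Valuation ι), IsProbabilityMeasure D ∧ (∀ᵐ v ∂D, Monotone v) ∧
      itemRev D ≠ ⊤ ∧ buyManyRev D ≠ 0 ∧
      ∀ x : ℝ≥0∞, 2 * x ≤ L → x * itemRev D ≤ buyManyRev D := by
  set D₀ := spreadMeasure a A with hD₀
  have hmass : D₀ Set.univ = ∑ j : Fin L, ∑ _θ : Θ, 2⁻¹ ^ (j : ℕ) := by
    rw [← lintegral_one, hD₀, spreadMeasure, lintegral_sum_smul_dirac]
    simp
  have hmass0 : D₀ Set.univ ≠ 0 := by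
    rw [hmass]
    intro h
    rw [Finset.sum_eq_zero_iff] at h
    have := h ⟨0, hL⟩ (Finset.mem_univ _)
    simp at this
  have hmasst : D₀ Set.univ ≠ ⊤ := by
    rw [hmass]
    exact ENNReal.sum_ne_top.2 fun j _ => ENNReal.sum_ne_top.2 fun θ _ =>
      ENNReal.pow_ne_top (by simp)
  set c := (D₀ Set.univ)⁻¹ with hc
  have hc0 : c ≠ 0 := ENNReal.inv_ne_zero.2 hmasst
  have hct : c ≠ ⊤ := ENNReal.inv_ne_top.2 hmass0
  have hitem : itemRev (c • D₀) = c * itemRev D₀ := by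
    simp only [itemRev, revenue_smul, ENNReal.mul_iSup]
  have hbuy : buyManyRev (c • D₀) = c * buyManyRev D₀ := by
    simp only [buyManyRev, revenue_smul, ENNReal.mul_iSup]
  have h1 := itemRev_spreadMeasure_le ha A hdisj hU hUcard
  have h2 := le_buyManyRev_spreadMeasure ha A hcard hinter
  rw [← hD₀] at h1 h2
  refine ⟨c • D₀, ⟨?_⟩, ?_, ?_, ?_, ?_⟩
  · rw [Measure.smul_apply, smul_eq_mul, hc, ENNReal.inv_mul_cancel hmass0 hmasst]
  · refine Measure.ae_smul_measure ?_ c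
    rw [ae_iff, hD₀, spreadMeasure, Measure.finsetSum_apply]
    refine Finset.sum_eq_zero fun j _ => ?_
    rw [Measure.finsetSum_apply]
    refine Finset.sum_eq_zero fun θ _ => ?_
    rw [Measure.smul_apply, Measure.dirac_apply]
    simp [spreadValuation_mono]
  · rw [hitem]
    exact ENNReal.mul_ne_top hct (ne_top_of_le_ne_top (by finiteness) h1)
  · rw [hbuy]
    refine mul_ne_zero hc0 fun h => ?_
    rw [h] at h2
    simp [hL.ne'] at h2
  · intro x hx
    rw [hitem, hbuy, mul_left_comm]
    gcongr
    calc x * itemRev D₀ ≤ x * (2 * Fintype.card Θ) := by gcongr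
      _ = 2 * x * Fintype.card Θ := by ring
      _ ≤ L * Fintype.card Θ := by gcongr
      _ ≤ _ := h2

end Separation

/-! ### Lines in a finite plane -/

section Lines

variable {ι : Type} [DecidableEq ι] {R : Type} [CommRing R] [Fintype R]

/-- The items on the line `y = σ x + b` of the plane `R × R`, embedded into the items. -/
def lineItems (e : R × R ↪ ι) (σ b : R) : Finset ι :=
  Finset.univ.map ((⟨fun x => (x, σ * x + b), fun _ _ h => congrArg Prod.fst h⟩ :
    R ↪ R × R).trans e)

omit [DecidableEq ι] in
lemma mem_lineItems {e : R × R ↪ ι} {σ b : R} {i : ι} :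
    i ∈ lineItems e σ b ↔ ∃ x, e (x, σ * x + b) = i := by
  simp only [lineItems, Finset.mem_map, Finset.mem_univ, true_and]
  rfl

omit [DecidableEq ι] in
lemma card_lineItems (e : R × R ↪ ι) (σ b : R) : (lineItems e σ b).card = Fintype.card R := by
  simp [lineItems]

omit [DecidableEq ι] in
lemma lineItems_disjoint {e : R × R ↪ ι} {σ b b' : R} {i : ι} (h : i ∈ lineItems e σ b)
    (h' : i ∈ lineItems e σ b') : b = b' := by
  obtain ⟨x, rfl⟩ := mem_lineItems.1 h
  obtain ⟨x', hx'⟩ := mem_lineItems.1 h'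
  obtain ⟨rfl, h2⟩ := Prod.mk_inj.1 (e.injective hx')
  exact (add_left_cancel h2).symm

lemma card_lineItems_inter_le_one (e : R × R ↪ ι) {σ σ' : R} (hσ : IsUnit (σ - σ')) (b b' : R) :
    (lineItems e σ b ∩ lineItems e σ' b').card ≤ 1 := by
  refine Finset.card_le_one.2 fun i hi i' hi' => ?_
  rw [Finset.mem_inter, mem_lineItems, mem_lineItems] at hi hi'
  obtain ⟨⟨x, rfl⟩, ⟨x₁, hx₁⟩⟩ := hi
  obtain ⟨⟨y, rfl⟩, ⟨y₁, hy₁⟩⟩ := hi'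
  obtain ⟨rfl, hx⟩ := Prod.mk_inj.1 (e.injective hx₁)
  obtain ⟨rfl, hy⟩ := Prod.mk_inj.1 (e.injective hy₁)
  have h : (σ - σ') * x₁ = (σ - σ') * y₁ := by linear_combination hy - hx
  rw [hσ.mul_left_cancel h]

variable [Fintype ι]

/-- Lines of `m + 1` slopes form almost disjoint bundles. Unit differences of the slopes make lines
of different slopes meet at most once. -/
lemma exists_gap_of_slopes {m : ℕ} (e : R × R ↪ ι) (s : Fin (m + 1) → R)
    (hs : ∀ j j', j ≠ j' → IsUnit (s j - s j')) (hR : 2 ^ m ≤ Fintype.card R) :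
    ∃ D : Measure (Valuation ι), IsProbabilityMeasure D ∧ (∀ᵐ v ∂D, Monotone v) ∧
      itemRev D ≠ ⊤ ∧ buyManyRev D ≠ 0 ∧
      ∀ x : ℝ≥0∞, 2 * x ≤ (m + 1 : ℕ) → x * itemRev D ≤ buyManyRev D := by
  have hR0 : 0 < Fintype.card R := lt_of_lt_of_le (by positivity) hR
  refine exists_gap (Nat.succ_pos m) hR0 (fun j b => lineItems e (s j) b)
    (fun j b => card_lineItems _ _ _) ?_ (fun j b b' i h h' => lineItems_disjoint h h')
    (U := Finset.univ.map e) ?_ ?_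
  · intro j b j' b'
    by_cases hj : j = j'
    · subst hj
      refine Nat.mul_le_mul_left _ ?_
      rw [← card_lineItems e (s j) b]
      exact Finset.card_le_card Finset.inter_subset_left
    · calc 2 ^ (j' : ℕ) * (lineItems e (s j) b ∩ lineItems e (s j') b').card
          ≤ 2 ^ m * 1 := Nat.mul_le_mul
            (Nat.pow_le_pow_right two_pos (Nat.lt_succ_iff.1 j'.2))
            (card_lineItems_inter_le_one e (hs j j' hj) b b')
        _ ≤ Fintype.card R := by rw [mul_one]; exact hR
        _ ≤ _ := Nat.le_mul_of_pos_left _ (by positivity)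
  · intro j b i hi
    obtain ⟨x, rfl⟩ := mem_lineItems.1 hi
    simp
  · simp

/-- If there are at least `4 ^ m` items, there are bundles as above: for `m ≥ 1`, the lines over
the field with `2 ^ m` elements, and for `m = 0` a single item (the plane over the zero ring). -/
lemma exists_gap_of_card {m : ℕ} (h : 4 ^ m ≤ Fintype.card ι) :
    ∃ D : Measure (Valuation ι), IsProbabilityMeasure D ∧ (∀ᵐ v ∂D, Monotone v) ∧
      itemRev D ≠ ⊤ ∧ buyManyRev D ≠ 0 ∧
      ∀ x : ℝ≥0∞, 2 * x ≤ (m + 1 : ℕ) → x * itemRev D ≤ buyManyRev D := by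
  rcases Nat.eq_zero_or_pos m with rfl | hm
  · obtain ⟨e⟩ : Nonempty (PUnit.{1} × PUnit.{1} ↪ ι) :=
      Function.Embedding.nonempty_of_card_le (by simpa using h)
    exact exists_gap_of_slopes e (fun _ => 0)
      (fun j j' hj => absurd (Subsingleton.elim (α := Fin 1) j j') hj) (by simp)
  · have : Fact (Nat.Prime 2) := ⟨Nat.prime_two⟩
    let F := GaloisField 2 m
    have : Fintype F := Fintype.ofFinite F
    have hcard : Fintype.card F = 2 ^ m := by
      rw [← Nat.card_eq_fintype_card]
      exact GaloisField.card 2 m hm.ne'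
    obtain ⟨e⟩ : Nonempty (F × F ↪ ι) := Function.Embedding.nonempty_of_card_le (by
      rw [Fintype.card_prod, hcard, ← mul_pow]
      exact h)
    obtain ⟨s⟩ : Nonempty (Fin (m + 1) ↪ F) := Function.Embedding.nonempty_of_card_le (by
      rw [Fintype.card_fin, hcard]
      exact Nat.lt_two_pow_self)
    exact exists_gap_of_slopes e s
      (fun j j' hj => (sub_ne_zero.2 (s.injective.ne hj)).isUnit) hcard.ge

end Lines

/-! ### The approximation ratio of item pricing and its tightness -/

/-- With a single item in every category, every valuation is a category valuation. -/
lemma isCategoryValuation_of_single {k : ℕ} (v : Valuation (CategoryItem fun _ : Fin k => 1)) :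
    IsCategoryValuation v := by
  intro S T h
  have hmem : ∀ (S : Finset (CategoryItem fun _ : Fin k => 1)) (a : Fin k) (x : Fin 1),
      (⟨a, x⟩ : CategoryItem fun _ : Fin k => 1) ∈ S ↔ bestItem S a ≠ ⊥ := by
    intro S a x
    rw [Ne, bestItem, Finset.max_eq_bot, Finset.filter_eq_empty_iff]
    push Not
    constructor
    · exact fun hx => ⟨x, Finset.mem_univ _, hx⟩
    · rintro ⟨y, -, hy⟩
      rwa [Subsingleton.elim x y]
  congr 1
  ext ⟨a, x⟩
  rw [hmem, hmem, h a]

end OrderedItems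

theorem mainTheorem1 :
    -- item pricing is an `O(1 + log k)`-approximation to the optimal buy-many revenue
    (∃ C : ℝ, 0 < C ∧
      -- for partially ordered items of width `k`
      (∀ (ι : Type) [Fintype ι] [DecidableEq ι] [PartialOrder ι]
          (D : Measure (OrderedItems.Valuation ι)) [IsProbabilityMeasure D],
        (∀ᵐ v ∂D, Monotone v ∧ OrderedItems.IsPartiallyOrdered v) →
        OrderedItems.buyManyRev D ≤
          ENNReal.ofReal (C * (1 + Real.log (OrderedItems.width ι))) *
            OrderedItems.itemRev D) ∧
      -- for `k` categories
      (∀ (k : ℕ) (m : Fin k → ℕ)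
          (D : Measure (OrderedItems.Valuation (OrderedItems.CategoryItem m)))
          [IsProbabilityMeasure D],
        (∀ᵐ v ∂D, Monotone v ∧ OrderedItems.IsCategoryValuation v) →
        OrderedItems.buyManyRev D ≤
          ENNReal.ofReal (C * (1 + Real.log k)) * OrderedItems.itemRev D) ∧
      -- for totally ordered items, within a constant factor
      (∀ (n : ℕ) (D : Measure (OrderedItems.Valuation (Fin n))) [IsProbabilityMeasure D],
        (∀ᵐ v ∂D, OrderedItems.IsTotallyOrdered v) →
        OrderedItems.buyManyRev D ≤ ENNReal.ofReal C * OrderedItems.itemRev D)) ∧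
    -- and the gap is tight for every number `k` of (non-empty) categories
    (∃ c : ℝ, 0 < c ∧ ∀ k : ℕ, 1 ≤ k →
      ∃ m : Fin k → ℕ, (∀ a, 1 ≤ m a) ∧
        ∃ D : Measure (OrderedItems.Valuation (OrderedItems.CategoryItem m)),
          IsProbabilityMeasure D ∧
          (∀ᵐ v ∂D, Monotone v ∧ OrderedItems.IsCategoryValuation v) ∧
          0 < OrderedItems.itemRev D ∧ OrderedItems.buyManyRev D < ⊤ ∧
          ENNReal.ofReal (c * (1 + Real.log k)) * OrderedItems.itemRev D ≤
            OrderedItems.buyManyRev D) := by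
  have hcat : ∀ (k : ℕ) (m : Fin k → ℕ)
      (D : Measure (OrderedItems.Valuation (OrderedItems.CategoryItem m))),
      (∀ᵐ v ∂D, Monotone v ∧ OrderedItems.IsCategoryValuation v) →
      OrderedItems.buyManyRev D ≤
        ENNReal.ofReal (16 * (1 + Real.log k)) * OrderedItems.itemRev D := fun k m D hD =>
    OrderedItems.buyManyRev_le D
      (hD.mono fun v hv => ⟨hv.1, hv.2.isPartiallyOrdered⟩)
      (OrderedItems.width_categoryItem_le m)
  refine ⟨⟨16, by norm_num, ?_, ?_, ?_⟩, 1 / 8, by norm_num, ?_⟩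
  · intro ι _ _ _ D _ hD
    exact OrderedItems.buyManyRev_le D hD le_rfl
  · intro k m D _ hD
    exact hcat k m D hD
  · intro n D _ hD
    simpa using OrderedItems.buyManyRev_le D
      (hD.mono fun v hv => ⟨hv.monotone, hv.isPartiallyOrdered⟩) (OrderedItems.width_fin_le n)
  · intro k hk
    obtain ⟨D, hprob, hmono, hitem, hbuy, hgap⟩ := OrderedItems.exists_gap_of_card
      (ι := OrderedItems.CategoryItem fun _ : Fin k => 1) (m := Nat.log 4 k) (by
        simpa using Nat.pow_log_le_self 4 (Nat.one_le_iff_ne_zero.1 hk))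
    have hD : ∀ᵐ v ∂D, Monotone v ∧ OrderedItems.IsCategoryValuation v :=
      hmono.mono fun v hv => ⟨hv, OrderedItems.isCategoryValuation_of_single v⟩
    have hle := hcat k _ D hD
    refine ⟨fun _ => 1, fun _ => le_rfl, D, hprob, hD, pos_iff_ne_zero.2 fun h => hbuy ?_, ?_,
      hgap _ ?_⟩
    -- both degenerate cases are excluded by the upper bound
    · rw [h, mul_zero] at hle
      exact le_antisymm hle zero_le
    · exact hle.trans_lt (ENNReal.mul_lt_top ENNReal.ofReal_lt_top (lt_top_iff_ne_top.2 hitem))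
    · have h1 : Real.log k ≤ (Nat.log 4 k + 1) * Real.log 4 := by
        have h2 : k < 4 ^ (Nat.log 4 k + 1) := Nat.lt_pow_succ_log_self (by norm_num) k
        have h3 : (k : ℝ) ≤ 4 ^ (Nat.log 4 k + 1) := by exact_mod_cast h2.le
        have h4 := Real.log_le_log (by exact_mod_cast hk) h3
        rw [Real.log_pow] at h4
        exact_mod_cast h4
      have h5 : Real.log 4 ≤ 2 := by
        have h6 : Real.log 4 = 2 * Real.log 2 := by
          rw [show (4 : ℝ) = 2 ^ 2 by norm_num, Real.log_pow]
          norm_num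
        linarith [Real.log_two_lt_d9]
      have h7 : (0 : ℝ) ≤ Nat.log 4 k := Nat.cast_nonneg _
      rw [show (2 : ENNReal) = ENNReal.ofReal 2 by simp, ← ENNReal.ofReal_mul (by norm_num),
        ← ENNReal.ofReal_natCast]
      refine ENNReal.ofReal_le_ofReal ?_
      push_cast
      nlinarith
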